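/- All graphs are finite and simple; $\mathrm{d}$ denotes graph distance and $\mathrm{diam}$ the diameter. A $3$-AP in a graph $G$ is a triple of vertices $(v_1,v_2,v_3)$ with $\mathrm{d}(v_1,v_2)=\mathrm{d}(v_2,v_3)$; it is rainbow under a vertex coloring if its three vertices have distinct colors. $\mathrm{aw}(G,3)$ is the least $r\ge 1$ such that every exact (i.e. surjective) $r$-coloring $V(G)\to\{1,\dots,r\}$ admits a rainbow $3$-AP. $G\square H$ is the Cartesian product. A graph $G$ is $3$-peripheral if it has three distinct vertices that are pairwise at distance $\mathrm{diam}(G)$. A vertex is peripheral if its eccentricity equals $\mathrm{diam}(G)$. For a tree $T$ and a peripheral vertex $v$, let $T_{v^-}$ be obtained from $T$ by removing all vertices at distance $\mathrm{diam}(T)$ from $v$; for any vertex $u$, let $T_{u^+}$ be obtained from $T$ by attaching one new leaf to $u$. A tree $T$ with at least two vertices is weakly non-$3$-peripheral if it is not $3$-peripheral and either $\mathrm{diam}(T)$ is odd and $T_{v^-}$ is $3$-peripheral for every peripheral vertex $v$, or $\mathrm{diam}(T)$ is even and $T_{u^+}$ is $3$-peripheral for some vertex $u$. **Corollary 1.4.**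 Let $T$ and $T'$ be trees, each with at least two vertices. Then $\mathrm{aw}(T\square T',3)=3$ if at least one of the following holds: 1. $T$ or $T'$ is $3$-peripheral; 2. $\mathrm{diam}(T\square T')$ is even and $T$ or $T'$ is isomorphic to the path $P_2$ on two vertices; 3. $\mathrm{diam}(T\square T')$ is even and $T$ or $T'$ is weakly non-$3$-peripheral. In all other cases $\mathrm{aw}(T\square T',3)=4$. -/

import Mathlib

namespace AntiVdW

/-- The list of vertices `v 0, …, v (k - 1)` is a `k`-term arithmetic progression in `G`: all
consecutive vertices are at one and the same (finite) distance `d`. -/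
def IsAP {V : Type*} (G : SimpleGraph V) {k : ℕ} (v : Fin k → V) : Prop :=
  ∃ d : ℕ, ∀ (i : ℕ) (hi : i + 1 < k),
    G.edist (v ⟨i, Nat.lt_of_succ_lt hi⟩) (v ⟨i + 1, hi⟩) = (d : ℕ∞)

/-- The coloring `c` of the vertices of `G` admits a rainbow `k`-term arithmetic progression. -/
def HasRainbowAP {V : Type*} (G : SimpleGraph V) (k : ℕ) {r : ℕ} (c : V → Fin r) : Prop :=
  ∃ v : Fin k → V, IsAP G v ∧ Function.Injective (c ∘ v)

/-- The anti-van der Waerden number: the least positive number `r` of colors such that every exact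
(that is, surjective) `r`-coloring of the vertices of `G` admits a rainbow `k`-term arithmetic
progression. For a finite graph such `r` exist, since there are no exact colorings with more
colors than vertices; `r = 0` is excluded because there `r`-colorings do not exist either. -/
noncomputable def aw {V : Type*} (G : SimpleGraph V) (k : ℕ) : ℕ :=
  sInf {r : ℕ | 0 < r ∧ ∀ c : V → Fin r, Function.Surjective c → HasRainbowAP G k c}

/-- A vertex is peripheral if its eccentricity is the diameter. -/
def IsPeripheralVertex {V : Type*} (G : SimpleGraph V) (v : V) : Prop :=
  G.eccent v = G.ediam

/-- `G` is `n`-peripheral: it has `n` distinct vertices that are pairwise at distance the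
diameter of `G`. -/
def IsPeripheral {V : Type*} (n : ℕ) (G : SimpleGraph V) : Prop :=
  ∃ u : Fin n → V, Function.Injective u ∧ ∀ i j, i ≠ j → G.dist (u i) (u j) = G.diam

/-- The graph `T_{v⁻}`: remove from `T` all vertices that realize the diameter of `T` with `v`. -/
def removeFar {V : Type*} (T : SimpleGraph V) (v : V) :
    SimpleGraph {x : V // T.dist v x ≠ T.diam} :=
  T.induce {x : V | T.dist v x ≠ T.diam}

/-- The graph `T_{u⁺}`: add to `T` one new vertex `none`, adjacent to `u` only. -/
def addLeaf {V : Type*} (T : SimpleGraph V) (u : V) : SimpleGraph (Option V) :=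
  T.map some ⊔ SimpleGraph.edge none (some u)

/-- Weakly non-3-peripheral (for nontrivial trees): `T` is non-3-peripheral and, if the diameter
is odd, `T_{v⁻}` is 3-peripheral for all peripheral vertices `v`; if the diameter is even,
`T_{v⁺}` is 3-peripheral for some vertex `v`. -/
def IsWeaklyNonThreePeripheral {V : Type*} (T : SimpleGraph V) : Prop :=
  ¬ IsPeripheral 3 T ∧
    ((Odd T.diam ∧ ∀ v, IsPeripheralVertex T v → IsPeripheral 3 (removeFar T v)) ∨
      (Even T.diam ∧ ∃ v, IsPeripheral 3 (addLeaf T v)))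

/-- The hypothesis on `T` and `T'` under which the anti-van der Waerden number of the Cartesian
product is three. -/
def ThreeCase {V W : Type*} (T : SimpleGraph V) (T' : SimpleGraph W) : Prop :=
  (IsPeripheral 3 T ∨ IsPeripheral 3 T') ∨
    (Even (T.boxProd T').diam ∧
      (Nonempty (T ≃g SimpleGraph.pathGraph 2) ∨ Nonempty (T' ≃g SimpleGraph.pathGraph 2))) ∨
    (Even (T.boxProd T').diam ∧
      (IsWeaklyNonThreePeripheral T ∨ IsWeaklyNonThreePeripheral T'))

end AntiVdW

namespace AntiVdW

/-! Distances in the product are sums of tree distances, so any three points have a median, and a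
coloring that uses at least three colors has a geodesic `x`–`m`–`y` showing three of them. Take one
of minimal length `d` and suppose that there is no rainbow 3-AP. Then `d` is odd, since otherwise a
midpoint completes a rainbow 3-AP; all inner points of all geodesics from `x` to `y` have the color
of `m` (`MinTriple.color_between`); and `x`, `y` differ in both coordinates (`Linked.snd_ne`,
`Linked.fst_ne`). The central consequence is rigidity, `Linked.sphere`: any point at distance `d`
from one end can replace the other end. It excludes a fourth color (`Linked.color_cases`), so the
number is at most 4.

To show that the number is 3, jump between spheres of radius `d` until some point must have the
color of an end and yet is an inner point of a shortest three-colored geodesic. With a 3-peripheral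
factor this contradicts every `d`. With a factor that is an edge or weakly non-3-peripheral it shows
that `d` is at least the diameter of the product, which is absurd if that diameter is even, as `d`
is odd.

In all other cases two sets are constructed, each being the sphere of one odd radius about every
point of the other. Coloring them with two colors and the rest with a third is rainbow-free, because
perimeters of triangles are even (`exists_rainbowFree_of_spheres`). The radius is the diameter of
the product if that is odd, and one less if it is even. `exists_isStrongEndPair` extracts what the
even case needs. -/

/-- A `ℕ`-valued metric with intermediate points in which any three points have a median. -/
structure IsMedianMetric {X : Type*} (δ : X → X → ℕ) : Prop where
  eq_of_zero : ∀ {x y}, δ x y = 0 → x = y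
  self : ∀ x, δ x x = 0
  comm : ∀ x y, δ x y = δ y x
  triangle : ∀ x y z, δ x z ≤ δ x y + δ y z
  exists_between : ∀ x y k, k ≤ δ x y → ∃ z, δ x z = k ∧ δ x z + δ z y = δ x y
  exists_median : ∀ x y z, ∃ m,
    δ x m + δ m y = δ x y ∧ δ y m + δ m z = δ y z ∧ δ x m + δ m z = δ x z

/-- The properties of the distance of a tree that are used below: besides medians, all perimeters
of triangles are even and the four-point condition holds. -/
structure IsTreeMetric {X : Type*} (δ : X → X → ℕ) : Prop extends IsMedianMetric δ where
  even_perimeter : ∀ x y z, Even (δ x y + δ y z + δ x z)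
  four_point : ∀ x y z w, δ x y + δ z w ≤ max (δ x z + δ y w) (δ x w + δ y z)

/-! ### Distances in a tree: four-point condition, parity, medians. -/

section Tree

variable {V : Type*} {T : SimpleGraph V}

lemma exists_adj_dist_add_one (hT : T.Connected) {x y : V} (h : x ≠ y) :
    ∃ x', T.Adj x x' ∧ T.dist x' y + 1 = T.dist x y := by
  obtain ⟨p, hp⟩ := hT.exists_walk_length_eq_dist x y
  cases p with
  | nil => exact absurd rfl h
  | @cons _ x' _ hadj q =>
    refine ⟨x', hadj, ?_⟩
    have h1 := SimpleGraph.dist_le q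
    have h2 := hT.dist_triangle (u := x) (v := x') (w := y)
    have h3 : T.dist x x' = 1 := SimpleGraph.dist_eq_one_iff_adj.2 hadj
    simp only [SimpleGraph.Walk.length_cons] at hp
    omega

lemma eq_of_adj_of_dist_add_one (hT : T.IsTree) {x x₁ x₂ y : V} (h₁ : T.Adj x x₁)
    (h₂ : T.Adj x x₂) (hd₁ : T.dist x₁ y + 1 = T.dist x y) (hd₂ : T.dist x₂ y + 1 = T.dist x y) :
    x₁ = x₂ := by
  obtain ⟨p, hp⟩ := hT.1.exists_walk_length_eq_dist x₁ y
  obtain ⟨q, hq⟩ := hT.1.exists_walk_length_eq_dist x₂ y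
  have hp' : (SimpleGraph.Walk.cons h₁ p).IsPath :=
    SimpleGraph.Walk.isPath_of_length_eq_dist _ (by simp [hp, hd₁])
  have hq' : (SimpleGraph.Walk.cons h₂ q).IsPath :=
    SimpleGraph.Walk.isPath_of_length_eq_dist _ (by simp [hq, hd₂])
  have := congrArg (fun w : T.Path x y ↦ w.1.snd)
    ((hT.2.subsingleton_path x y).elim ⟨_, hp'⟩ ⟨_, hq'⟩)
  simpa using this

/-- The edge `x x'` separates `y` from `z`: a step from `x` towards `z` cannot lead back towards
`y`, because the neighbor of `x` nearer to `y` is unique. -/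
lemma dist_add_dist_of_adj (hT : T.IsTree) {x x' y z : V} (h : T.Adj x x')
    (hy : T.dist x' y + 1 = T.dist x y) (hz : T.dist x' z = T.dist x z + 1) :
    T.dist y z = T.dist y x + T.dist x z := by
  induction hn : T.dist x z generalizing x x' with
  | zero =>
    rw [hT.1.dist_eq_zero_iff] at hn
    subst hn; rfl
  | succ n ih =>
    have hne : x ≠ z := by
      rintro rfl; simp at hn
    obtain ⟨x₂, hadj, hd⟩ := exists_adj_dist_add_one hT.1 hne
    have hx₂ : T.dist x₂ y = T.dist x y + 1 := by
      rcases hT.dist_eq_dist_add_one_of_adj y hadj with h' | h'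
      · have := eq_of_adj_of_dist_add_one hT h hadj hy
          (by rw [T.dist_comm, T.dist_comm (u := x)]; omega)
        subst this
        omega
      · rw [T.dist_comm, T.dist_comm (u := x)]; omega
    have := ih hadj.symm (by omega) (by omega) (by omega)
    rw [this, T.dist_comm (u := y), T.dist_comm (u := y) (v := x)]
    omega

lemma dist_cases (hT : T.IsTree) {x x' : V} (h : T.Adj x x') (z : V) :
    T.dist x' z + 1 = T.dist x z ∨ T.dist x' z = T.dist x z + 1 := by
  rw [T.dist_comm, T.dist_comm (u := x)]
  rcases hT.dist_eq_dist_add_one_of_adj z h with h' | h' <;> omega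

lemma four_point_dist (hT : T.IsTree) (x y z w : V) :
    T.dist x y + T.dist z w ≤
      max (T.dist x z + T.dist y w) (T.dist x w + T.dist y z) := by
  induction hn : T.dist x y generalizing x with
  | zero =>
    rw [hT.1.dist_eq_zero_iff] at hn
    subst hn
    have := hT.1.dist_triangle (u := z) (v := x) (w := w)
    rw [T.dist_comm (u := z) (v := x)] at this
    omega
  | succ n ih =>
    have hne : x ≠ y := by
      rintro rfl; simp at hn
    obtain ⟨x', hadj, hd⟩ := exists_adj_dist_add_one hT.1 hne
    have IH := ih x' (by omega)
    have htri := hT.1.dist_triangle (u := z) (v := x) (w := w)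
    have c1 := T.dist_comm (u := z) (v := x)
    have c2 := T.dist_comm (u := x) (v := y)
    have c3 := T.dist_comm (u := z) (v := w)
    rcases dist_cases hT hadj z with hz | hz <;> rcases dist_cases hT hadj w with hw | hw
    · omega
    · have h1 := dist_add_dist_of_adj hT hadj hz hw
      have h2 := dist_add_dist_of_adj hT hadj hd hw
      omega
    · have h1 := dist_add_dist_of_adj hT hadj hw hz
      have h2 := dist_add_dist_of_adj hT hadj hd hz
      have c4 := T.dist_comm (u := w) (v := x)
      omega
    · have h1 := dist_add_dist_of_adj hT hadj hd hz
      have h2 := dist_add_dist_of_adj hT hadj hd hw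
      omega

lemma even_perimeter_dist (hT : T.IsTree) (x y z : V) :
    Even (T.dist x y + T.dist y z + T.dist x z) := by
  induction hn : T.dist x y generalizing x with
  | zero =>
    rw [hT.1.dist_eq_zero_iff] at hn
    subst hn
    exact ⟨T.dist x z, by omega⟩
  | succ n ih =>
    have hne : x ≠ y := by
      rintro rfl; simp at hn
    obtain ⟨x', hadj, hd⟩ := exists_adj_dist_add_one hT.1 hne
    have IH := ih x' (by omega)
    rw [Nat.even_iff] at IH ⊢
    rcases dist_cases hT hadj z with hz | hz <;> omega

lemma exists_dist_between (hT : T.Connected) (x y : V) (k : ℕ) (hk : k ≤ T.dist x y) :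
    ∃ z, T.dist x z = k ∧ T.dist x z + T.dist z y = T.dist x y := by
  induction k with
  | zero => exact ⟨x, by simp⟩
  | succ k ih =>
    obtain ⟨z, hz, hz'⟩ := ih (by omega)
    have hne : z ≠ y := by
      rintro rfl; simp at hz'; omega
    obtain ⟨w, hadj, hw⟩ := exists_adj_dist_add_one hT hne
    have h1 := hT.dist_triangle (u := x) (v := z) (w := w)
    have h2 := hT.dist_triangle (u := x) (v := w) (w := y)
    have h3 : T.dist z w = 1 := SimpleGraph.dist_eq_one_iff_adj.2 hadj
    exact ⟨w, by omega, by omega⟩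

lemma isTreeMetric_dist (hT : T.IsTree) : IsTreeMetric T.dist where
  eq_of_zero h := hT.1.dist_eq_zero_iff.1 h
  self _ := SimpleGraph.dist_self
  comm _ _ := T.dist_comm
  triangle _ _ _ := hT.1.dist_triangle
  exists_between := exists_dist_between hT.1
  even_perimeter := even_perimeter_dist hT
  four_point := four_point_dist hT
  exists_median x y z := by
    obtain ⟨k, hk⟩ := even_perimeter_dist hT x y z
    have t1 := hT.1.dist_triangle (u := x) (v := y) (w := z)
    have t2 := hT.1.dist_triangle (u := x) (v := z) (w := y)
    have t3 := hT.1.dist_triangle (u := y) (v := x) (w := z)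
    have c1 := T.dist_comm (u := y) (v := x)
    have c2 := T.dist_comm (u := z) (v := y)
    -- With `k` half the perimeter, `k - T.dist y z` is the Gromov product of `y` and `z` at `x`,
    -- the distance from `x` to the branching point.
    obtain ⟨m, hm, hm'⟩ := exists_dist_between hT.1 x y (k - T.dist y z) (by omega)
    have h4 := four_point_dist hT x y m z
    have t4 := hT.1.dist_triangle (u := x) (v := m) (w := z)
    have t5 := hT.1.dist_triangle (u := y) (v := m) (w := z)
    have c3 := T.dist_comm (u := m) (v := y)
    exact ⟨m, hm', by omega, by omega⟩

end Tree

/-! ### Shortest three-colored geodesics in a median metric. -/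

section Median

variable {X C : Type*} {δ : X → X → ℕ} {c : X → C}

/-- No three points `x, y, z` with `δ x y = δ y z` have distinct colors. -/
def RainbowFree (δ : X → X → ℕ) (c : X → C) : Prop :=
  ∀ x y z, δ x y = δ y z → c x ≠ c y → c y ≠ c z → c x = c z

/-- The point `m` lies between `x` and `y`, and the three points have distinct colors. -/
def RainbowBetween (δ : X → X → ℕ) (c : X → C) (x m y : X) : Prop :=
  δ x m + δ m y = δ x y ∧ c x ≠ c m ∧ c m ≠ c y ∧ c x ≠ c y

/-- The points `x, y` at distance `d` are the ends of a shortest three-colored geodesic, with the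
inner point `m` of the third color. -/
def MinTriple (δ : X → X → ℕ) (c : X → C) (d : ℕ) (x m y : X) : Prop :=
  δ x y = d ∧ RainbowBetween δ c x m y ∧ ∀ x' m' y', RainbowBetween δ c x' m' y' → d ≤ δ x' y'

lemma RainbowBetween.symm (hδ : IsMedianMetric δ) {x m y : X} (h : RainbowBetween δ c x m y) :
    RainbowBetween δ c y m x := by
  obtain ⟨h, h1, h2, h3⟩ := h
  refine ⟨?_, h2.symm, h1.symm, h3.symm⟩
  rw [hδ.comm y m, hδ.comm m x, hδ.comm y x]; omega

lemma MinTriple.symm (hδ : IsMedianMetric δ) {d : ℕ} {x m y : X} (h : MinTriple δ c d x m y) :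
    MinTriple δ c d y m x :=
  ⟨by rw [hδ.comm, h.1], h.2.1.symm hδ, h.2.2⟩

/-- The color of the median of three differently colored points differs from at least two of theirs,
so it is the inner point of a three-colored geodesic. -/
lemma exists_minTriple (hδ : IsMedianMetric δ) {x y z : X} (hxy : c x ≠ c y) (hyz : c y ≠ c z)
    (hxz : c x ≠ c z) : ∃ d x m y, MinTriple δ c d x m y := by
  have hex : ∃ d x m y, δ x y = d ∧ RainbowBetween δ c x m y := by
    obtain ⟨m, h1, h2, h3⟩ := hδ.exists_median x y z
    by_cases hx : c x = c m
    · exact ⟨_, y, m, z, rfl, h2, hx ▸ hxy.symm, hx ▸ hxz, hyz⟩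
    by_cases hy : c y = c m
    · exact ⟨_, x, m, z, rfl, h3, hx, hy ▸ hyz, hxz⟩
    · exact ⟨_, x, m, y, rfl, h1, hx, fun h ↦ hy h.symm, hxy⟩
  classical
  obtain ⟨x, m, y, hd, hr⟩ := Nat.find_spec hex
  exact ⟨Nat.find hex, x, m, y, hd, hr, fun x' m' y' h ↦ Nat.find_min' hex ⟨x', m', y', rfl, h⟩⟩

/-- Were `k` of another color, then `k, m, y` would be a shorter triple unless `k` has the color of
`y`; in that case `x, k, m` is a shorter one. -/
lemma MinTriple.color_eq_left (hδ : IsMedianMetric δ) {d : ℕ} {x m y k : X}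
    (h : MinTriple δ c d x m y) (hk : δ x k + δ k m = δ x m) (hkx : k ≠ x) : c k = c m := by
  obtain ⟨hd, ⟨hb, h1, h2, h3⟩, hmin⟩ := h
  by_contra hne
  have t1 := hδ.triangle x k y
  have t2 := hδ.triangle k m y
  have hkx' : δ x k ≠ 0 := fun h ↦ hkx (hδ.eq_of_zero h).symm
  have hmy : δ m y ≠ 0 := fun h ↦ h2 (by rw [hδ.eq_of_zero h])
  have hy : c k = c y := by
    by_contra h'
    have := hmin k m y ⟨by omega, hne, h2, h'⟩
    omega
  have := hmin x k m ⟨hk, by rw [hy]; exact h3, hne, h1⟩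
  omega

lemma MinTriple.color_eq_right (hδ : IsMedianMetric δ) {d : ℕ} {x m y k : X}
    (h : MinTriple δ c d x m y) (hk : δ m k + δ k y = δ m y) (hky : k ≠ y) : c k = c m :=
  (h.symm hδ).color_eq_left hδ (by rw [hδ.comm y k, hδ.comm k m, hδ.comm y m]; omega) hky

/-- A midpoint on a geodesic through `m` would have the color of `m` and complete a rainbow
progression. -/
lemma MinTriple.odd (hδ : IsMedianMetric δ) (hc : RainbowFree δ c) {d : ℕ} {x m y : X}
    (h : MinTriple δ c d x m y) : Odd d := by
  by_contra hodd
  obtain ⟨e, he⟩ := Nat.not_odd_iff_even.1 hodd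
  obtain ⟨hd, ⟨hb, h1, h2, h3⟩, hmin⟩ := h
  have hxy : d ≠ 0 := by
    rintro rfl; exact h3 (by rw [hδ.eq_of_zero hd])
  obtain ⟨k, hkx, hky, hkm⟩ : ∃ k, δ x k = e ∧ δ k y = e ∧ c k = c m := by
    rcases le_total e (δ x m) with hle | hle
    · obtain ⟨k, hk, hk'⟩ := hδ.exists_between x m e hle
      have t1 := hδ.triangle k m y
      have t2 := hδ.triangle x k y
      refine ⟨k, hk, by omega, MinTriple.color_eq_left hδ ⟨hd, ⟨hb, h1, h2, h3⟩, hmin⟩ hk' ?_⟩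
      rintro rfl
      rw [hδ.self] at hk; omega
    · obtain ⟨k, hk, hk'⟩ := hδ.exists_between m y (e - δ x m) (by omega)
      have t1 := hδ.triangle x m k
      have t2 := hδ.triangle x k y
      refine ⟨k, by omega, by omega,
        MinTriple.color_eq_right hδ ⟨hd, ⟨hb, h1, h2, h3⟩, hmin⟩ hk' ?_⟩
      rintro rfl
      rw [hδ.self] at hk'; omega
  exact h3 (hc x k y (by omega) (by rw [hkm]; exact h1) (by rw [hkm]; exact h2))

/-- On a shortest three-colored geodesic, and on all other geodesics between the same ends, all
inner points have the third color. -/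
lemma MinTriple.color_eq_of_ne (hδ : IsMedianMetric δ) (hc : RainbowFree δ c) {d : ℕ}
    {x m y z : X} (h : MinTriple δ c d x m y) (hz : δ x z + δ z y = δ x y) (hzx : z ≠ x)
    (hzB : c z ≠ c y) : c z = c m := by
  by_contra hne
  have hm := h
  have hodd := h.odd hδ hc
  obtain ⟨hd, ⟨hb, h1, h2, h3⟩, hmin⟩ := h
  have hxz0 : δ x z ≠ 0 := fun h ↦ hzx (hδ.eq_of_zero h).symm
  have hxm0 : δ x m ≠ 0 := fun h ↦ h1 (by rw [hδ.eq_of_zero h])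
  have hmy0 : δ m y ≠ 0 := fun h ↦ h2 (by rw [hδ.eq_of_zero h])
  have hzy0 : δ z y ≠ 0 := fun h ↦ hzB (by rw [hδ.eq_of_zero h])
  obtain ⟨n, n1, n2, n3⟩ := hδ.exists_median z m y
  -- By minimality the median of `z`, `m`, `y` has the color of `y`; if it were not `y` itself, `x,
  -- m, n` would be a shorter triple.
  have hny : n = y := by
    have hcn : c n = c y := by
      by_contra hny
      have e1 : c n = c z := by
        by_contra h'
        have := hmin z n y ⟨n3, fun h ↦ h' h.symm, hny, hzB⟩
        omega
      have := hmin m n y ⟨n2, by rw [e1]; exact Ne.symm hne, hny, h2⟩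
      omega
    by_contra hny
    have hny0 : δ n y ≠ 0 := fun h ↦ hny (hδ.eq_of_zero h)
    have t1 := hδ.triangle x m n
    have t2 := hδ.triangle x n y
    have := hmin x m n ⟨by omega, h1, by rw [hcn]; exact h2, by rw [hcn]; exact h3⟩
    omega
  subst hny
  have hcomm1 := hδ.comm n m
  have hcomm2 := hδ.comm z x
  have hcomm3 := hδ.comm z n
  have hlen := hmin z n m ⟨n1, hzB, h2.symm, hne⟩
  have t1 := hδ.triangle z x m
  -- Now `y` lies between `z` and `m`. The two routes from `z` to `m`, through `x` and through `y`,
  -- have total length `2 * d`, so minimality forces distance exactly `d`, and this is a second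
  -- minimal triple, with the color of `y` inside.
  have hm' : MinTriple δ c d z n m := ⟨by omega, ⟨n1, hzB, h2.symm, hne⟩, hmin⟩
  by_cases hf : 2 ≤ δ m n
  · obtain ⟨k, hk, hk'⟩ := hδ.exists_between m n 1 (by omega)
    have e1 : c k = c m := hm.color_eq_right hδ hk' (by rintro rfl; omega)
    have e2 : c k = c n := hm'.color_eq_right hδ
      (by rw [hδ.comm n k, hδ.comm k m, hδ.comm n m]; omega)
      (by rintro rfl; rw [hδ.self] at hk; omega)
    exact h2 (e1.symm.trans e2)
  · obtain ⟨j, hj⟩ := hodd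
    -- Here `m` is adjacent to `y`. The point `l` next to `y` towards `z` has the color of `y` (it
    -- is not `z`, as `d` is at least 3), and `l`, `m` are both at distance `d - 1` from `x`: a
    -- rainbow progression.
    obtain ⟨l, hl, hl'⟩ := hδ.exists_between z n (δ z n - 1) (by omega)
    have e1 : c l = c n := hm'.color_eq_left hδ hl'
      (by rintro rfl; rw [hδ.self] at hl; omega)
    have t2 := hδ.triangle x z l
    have t3 := hδ.triangle x l n
    have hcomm4 := hδ.comm l x
    exact h2 (e1 ▸ (hc l x m (by omega) (by rw [e1]; exact h3.symm) h1).symm)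

lemma MinTriple.color_between (hδ : IsMedianMetric δ) (hc : RainbowFree δ c) {d : ℕ}
    {x m y z : X} (h : MinTriple δ c d x m y) (hz : δ x z + δ z y = δ x y) (hzx : z ≠ x)
    (hzy : z ≠ y) : c z = c m := by
  by_cases hzB : c z = c y
  · refine (h.symm hδ).color_eq_of_ne hδ hc ?_ hzy ?_
    · rw [hδ.comm y z, hδ.comm z x, hδ.comm y x]; omega
    · rw [hzB]; exact h.2.1.2.2.2.symm
  · exact h.color_eq_of_ne hδ hc hz hzx hzB

/-- Points `x, y` at distance `d` that are the ends of a shortest three-colored geodesic with third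
color `w`. -/
def Linked (δ : X → X → ℕ) (c : X → C) (d : ℕ) (w : C) (x y : X) : Prop :=
  ∃ m, MinTriple δ c d x m y ∧ c m = w

lemma Linked.symm (hδ : IsMedianMetric δ) {d : ℕ} {w : C} {x y : X} (h : Linked δ c d w x y) :
    Linked δ c d w y x :=
  h.imp fun _ hm ↦ ⟨hm.1.symm hδ, hm.2⟩

lemma Linked.odd (hδ : IsMedianMetric δ) (hc : RainbowFree δ c) {d : ℕ} {w : C} {x y : X}
    (h : Linked δ c d w x y) : Odd d :=
  h.elim fun _ hm ↦ hm.1.odd hδ hc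

lemma Linked.dist_eq {d : ℕ} {w : C} {x y : X} (h : Linked δ c d w x y) : δ x y = d :=
  h.elim fun _ hm ↦ hm.1.1

lemma Linked.color_eq (hδ : IsMedianMetric δ) (hc : RainbowFree δ c) {d : ℕ} {w : C} {x y z : X}
    (h : Linked δ c d w x y) (hz : δ x z + δ z y = d) (hzx : δ x z ≠ 0) (hzy : δ z y ≠ 0) :
    c z = w := by
  obtain ⟨m, hm, rfl⟩ := h
  exact hm.color_between hδ hc (by rw [hm.1, hz]) (by rintro rfl; exact hzx (hδ.self _))
    (by rintro rfl; exact hzy (hδ.self _))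

lemma Linked.color_ne (hδ : IsMedianMetric δ) (hc : RainbowFree δ c) {d : ℕ} {w : C} {x y z : X}
    (h : Linked δ c d w x y) (hz : δ x z + δ z y = d) (hzx : δ x z ≠ 0) (hzy : δ z y ≠ 0) :
    c z ≠ c x := by
  rw [h.color_eq hδ hc hz hzx hzy]
  obtain ⟨m, hm, rfl⟩ := h
  exact hm.2.1.2.1.symm

/-- If `y` and `z` are at the same distance `d` from `x` and the geodesics from `x` to `y` and to
`z` share an inner point, then `z` inherits the properties of `y`. -/
lemma Linked.of_common (hδ : IsMedianMetric δ) (hc : RainbowFree δ c) {d : ℕ} {w : C} {x y z e : X}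
    (h : Linked δ c d w x y) (hz : δ x z = d) (hey : δ x e + δ e y = d) (hez : δ x e + δ e z = d)
    (he : δ x e ≠ 0) : Linked δ c d w x z ∧ c z = c y := by
  obtain ⟨m, hm, rfl⟩ := h
  obtain ⟨n, n1, n2, n3⟩ := hδ.exists_median x y z
  have t1 := hδ.triangle y e z
  have c1 := hδ.comm y e
  have c2 := hδ.comm y n
  have c3 := hδ.comm y x
  have hd := hm.1
  by_cases hny : n = y
  · subst hny
    have : n = z := hδ.eq_of_zero (by omega)
    subst this
    exact ⟨⟨m, hm, rfl⟩, rfl⟩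
  have hcn : c n = c m := hm.color_between hδ hc n1
    (by rintro rfl; rw [hδ.self] at n1 n3; omega) hny
  obtain ⟨-, ⟨hb, h1, h2, h3⟩, hmin⟩ := hm
  have hzy : c z = c y := by
    -- Both `x` and the median `n` are equidistant from `y` and `z`; the progression through `x`
    -- leaves only the color of `x` for `z`, and the one through `n` then is rainbow.
    by_contra hne
    have hzx : c z = c x := by
      by_contra hne'
      exact hne (hc y x z (by omega) h3.symm (fun h ↦ hne' h.symm)).symm
    exact hne (hc y n z (by omega) (by rw [hcn]; exact h2.symm)
      (by rw [hcn, hzx]; exact h1.symm)).symm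
  exact ⟨⟨n, ⟨hz, ⟨n3, by rw [hcn]; exact h1, by rw [hcn, hzy]; exact h2, by rw [hzy]; exact h3⟩,
    hmin⟩, hcn⟩, hzy⟩

end Median

/-! ### Rigidity of shortest three-colored geodesics in a product. -/

section Product

variable {V W C : Type*} {δ : V → V → ℕ} {δ' : W → W → ℕ} {c : V × W → C} {d : ℕ} {w : C}

/-- The distance of the Cartesian product. -/
def prodDist (δ : V → V → ℕ) (δ' : W → W → ℕ) (x y : V × W) : ℕ :=
  δ x.1 y.1 + δ' x.2 y.2

lemma IsMedianMetric.prod (hδ : IsMedianMetric δ) (hδ' : IsMedianMetric δ') :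
    IsMedianMetric (prodDist δ δ') where
  eq_of_zero {x y} h := by
    simp only [prodDist, Nat.add_eq_zero_iff] at h
    exact Prod.ext (hδ.eq_of_zero h.1) (hδ'.eq_of_zero h.2)
  self x := by simp [prodDist, hδ.self, hδ'.self]
  comm x y := by simp [prodDist, hδ.comm x.1, hδ'.comm x.2]
  triangle x y z := by
    have h1 := hδ.triangle x.1 y.1 z.1
    have h2 := hδ'.triangle x.2 y.2 z.2
    simp only [prodDist]; omega
  exists_between x y k hk := by
    simp only [prodDist] at hk ⊢
    obtain ⟨u, hu, hu'⟩ := hδ.exists_between x.1 y.1 (min k (δ x.1 y.1)) (by omega)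
    obtain ⟨v, hv, hv'⟩ := hδ'.exists_between x.2 y.2 (k - min k (δ x.1 y.1)) (by omega)
    exact ⟨(u, v), by dsimp only; omega, by dsimp only; omega⟩
  exists_median x y z := by
    obtain ⟨u, hu, hu', hu''⟩ := hδ.exists_median x.1 y.1 z.1
    obtain ⟨v, hv, hv', hv''⟩ := hδ'.exists_median x.2 y.2 z.2
    refine ⟨(u, v), ?_, ?_, ?_⟩ <;> simp only [prodDist] <;> omega

lemma prodDist_swap (x y : V × W) : prodDist δ' δ x.swap y.swap = prodDist δ δ' x y := by
  simp [prodDist, add_comm]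

lemma RainbowFree.swap (hc : RainbowFree (prodDist δ δ') c) :
    RainbowFree (prodDist δ' δ) (c ∘ Prod.swap) := fun x y z h ↦
  hc x.swap y.swap z.swap (by rwa [prodDist_swap, prodDist_swap])

lemma Linked.swap {x y : V × W} (h : Linked (prodDist δ δ') c d w x y) :
    Linked (prodDist δ' δ) (c ∘ Prod.swap) d w x.swap y.swap := by
  obtain ⟨m, ⟨hd, ⟨hb, h1, h2, h3⟩, hmin⟩, hw⟩ := h
  refine ⟨m.swap, ⟨by rw [prodDist_swap, hd], ⟨by simpa only [prodDist_swap] using hb, ?_⟩, ?_⟩,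
    by simpa using hw⟩
  · simpa using ⟨h1, h2, h3⟩
  · rintro x' m' y' ⟨hb', h'⟩
    rw [← prodDist_swap]
    exact hmin _ m'.swap _ ⟨by simpa only [prodDist_swap] using hb', h'⟩

lemma IsMedianMetric.exists_dist_eq_one [Nontrivial W] (hδ' : IsMedianMetric δ') (b : W) :
    ∃ u, δ' b u = 1 := by
  obtain ⟨z, hz⟩ := exists_ne b
  obtain ⟨u, hu, -⟩ := hδ'.exists_between b z 1
    (Nat.one_le_iff_ne_zero.2 fun h ↦ hz (hδ'.eq_of_zero h).symm)
  exact ⟨u, hu⟩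

/-- The ends of a shortest three-colored geodesic do not lie in a common fiber. -/
lemma Linked.snd_ne [Nontrivial W] (hδ : IsMedianMetric δ) (hδ' : IsMedianMetric δ')
    (hc : RainbowFree (prodDist δ δ') c) {x y : V × W}
    (h : Linked (prodDist δ δ') c d w x y) : x.2 ≠ y.2 := by
  have hp := hδ.prod hδ'
  have hodd := h.odd hp hc
  obtain ⟨a, b⟩ := x
  obtain ⟨a', b'⟩ := y
  rintro (rfl : b = b')
  obtain ⟨m, hm, -⟩ := h
  have hm' := hm
  obtain ⟨hd, ⟨hb, h1, h2, h3⟩, hmin⟩ := hm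
  have hd3 : 3 ≤ d := by
    obtain ⟨j, hj⟩ := hodd
    have e1 : prodDist δ δ' (a, b) m ≠ 0 := fun h ↦ h1 (by rw [hp.eq_of_zero h])
    have e2 : prodDist δ δ' m (a', b) ≠ 0 := fun h ↦ h2 (by rw [hp.eq_of_zero h])
    omega
  have hbb := hδ'.self b
  have hd' : δ a a' = d := by simpa [prodDist, hbb] using hd
  obtain ⟨b₁, hb₁⟩ := hδ'.exists_dist_eq_one b
  obtain ⟨a₁, ha₁, ha₁'⟩ := hδ.exists_between a a' 1 (by omega)
  obtain ⟨a₂, ha₂, ha₂'⟩ := hδ.exists_between a₁ a' (d - 2) (by omega)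
  have t1 := hδ.triangle a a₁ a₂
  have t2 := hδ.triangle a a₂ a'
  have cb := hδ'.comm b₁ b
  have hb₁b₁ := hδ'.self b₁
  have haa := hδ.self a₁
  have haa₂ := hδ.self a₂
  have ca₂ := hδ.comm a₂ a'
  have ca₁ := hδ.comm a₁ a'
  have ca := hδ.comm a a'
  have n₁ : c (a₁, b) = c m := hm'.color_between hp hc (by simp only [prodDist]; omega)
    (by intro h; cases h; omega) (by intro h; cases h; omega)
  have n₂ : c (a₂, b) = c m := hm'.color_between hp hc (by simp only [prodDist]; omega)
    (by intro h; cases h; omega) (by intro h; cases h; omega)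
  -- Shift the inner points next to the two ends into a neighboring fiber. Each shifted point
  -- belongs to two progressions, and together they leave it only the color of the nearer end.
  have hx : c (a₁, b₁) = c (a, b) := by
    by_contra hne
    have e : c (a₁, b₁) = c (a', b) := by
      by_contra hne'
      exact hne (hc (a, b) (a', b) (a₁, b₁) (by simp only [prodDist]; omega) h3
        (Ne.symm hne')).symm
    exact hne (hc (a, b) (a₁, b) (a₁, b₁) (by simp only [prodDist]; omega)
      (by rw [n₁]; exact h1) (by rw [n₁, e]; exact h2)).symm
  have hy : c (a₂, b₁) = c (a', b) := by
    by_contra hne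
    have e : c (a₂, b₁) = c (a, b) := by
      by_contra hne'
      exact hne (hc (a', b) (a, b) (a₂, b₁) (by simp only [prodDist]; omega) h3.symm
        (Ne.symm hne')).symm
    exact hne (hc (a', b) (a₂, b) (a₂, b₁) (by simp only [prodDist]; omega)
      (by rw [n₂]; exact h2.symm) (by rw [n₂, e]; exact h1.symm)).symm
  -- The shifted end gives another minimal triple, on one of whose geodesics `(a₂, b₁)` is an inner
  -- point with the color of an end.
  have hmt : MinTriple (prodDist δ δ') c d (a₁, b₁) (a₁, b) (a', b) :=
    ⟨by simp only [prodDist]; omega, ⟨by simp only [prodDist]; omega, by rw [hx, n₁]; exact h1,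
      by rw [n₁]; exact h2, by rw [hx]; exact h3⟩, hmin⟩
  have := hmt.color_between hp hc (z := (a₂, b₁)) (by simp only [prodDist]; omega)
    (by intro h; cases h; omega) (by intro h; cases h; omega)
  exact h2 (by rw [← n₁, ← this, hy])

lemma Linked.fst_ne [Nontrivial V] (hδ : IsMedianMetric δ) (hδ' : IsMedianMetric δ')
    (hc : RainbowFree (prodDist δ δ') c) {x y : V × W}
    (h : Linked (prodDist δ δ') c d w x y) : x.1 ≠ y.1 :=
  h.swap.snd_ne hδ' hδ hc.swap

/-- All points at distance `d` from an end of a shortest three-colored geodesic of length `d` have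
the color of the other end. -/
lemma Linked.sphere [Nontrivial V] [Nontrivial W] (hδ : IsMedianMetric δ)
    (hδ' : IsMedianMetric δ') (hc : RainbowFree (prodDist δ δ') c) {x y z : V × W}
    (h : Linked (prodDist δ δ') c d w x y) (hz : prodDist δ δ' x z = d) :
    Linked (prodDist δ δ') c d w x z ∧ c z = c y := by
  have hp := hδ.prod hδ'
  have h1 : δ x.1 y.1 ≠ 0 := fun h0 ↦ h.fst_ne hδ hδ' hc (hδ.eq_of_zero h0)
  have h2 : δ' x.2 y.2 ≠ 0 := fun h0 ↦ h.snd_ne hδ hδ' hc (hδ'.eq_of_zero h0)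
  have hd := h.dist_eq
  have s1 := hδ.self x.1
  have s2 := hδ'.self x.2
  have s3 := hδ.self y.1
  have s4 := hδ'.self y.2
  -- Replace `y` by `z` in two moves, one coordinate at a time, each time between geodesics sharing
  -- an inner point. In the coordinate where `z` is at least as far from `x` as `y`, first put a
  -- point on the geodesic towards `z`.
  by_cases hle : δ' x.2 y.2 ≤ δ' x.2 z.2
  · obtain ⟨b, hb, hb'⟩ := hδ'.exists_between x.2 z.2 _ hle
    have s5 := hδ'.self b
    simp only [prodDist] at hz hd
    obtain ⟨l, e⟩ := h.of_common hp hc (z := (y.1, b)) (e := (y.1, x.2))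
      (by simp only [prodDist]; omega) (by simp only [prodDist]; omega)
      (by simp only [prodDist]; omega) (by simp only [prodDist]; omega)
    rw [← e]
    exact l.of_common hp hc (e := (x.1, b)) (by simp only [prodDist]; omega)
      (by simp only [prodDist]; omega) (by simp only [prodDist]; omega)
      (by simp only [prodDist]; omega)
  · simp only [prodDist] at hz hd
    obtain ⟨a, ha, ha'⟩ := hδ.exists_between x.1 z.1 (δ x.1 y.1) (by omega)
    have s5 := hδ.self a
    obtain ⟨l, e⟩ := h.of_common hp hc (z := (a, y.2)) (e := (x.1, y.2))
      (by simp only [prodDist]; omega) (by simp only [prodDist]; omega)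
      (by simp only [prodDist]; omega) (by simp only [prodDist]; omega)
    rw [← e]
    exact l.of_common hp hc (e := (a, x.2)) (by simp only [prodDist]; omega)
      (by simp only [prodDist]; omega) (by simp only [prodDist]; omega)
      (by simp only [prodDist]; omega)

/-- Otherwise the sphere about `x` would contain a point in the fiber of `x`, and that point would
be linked to `x`. -/
lemma Linked.dist_fst_lt [Nontrivial V] [Nontrivial W] (hδ : IsMedianMetric δ)
    (hδ' : IsMedianMetric δ') (hc : RainbowFree (prodDist δ δ') c) {x y : V × W}
    (h : Linked (prodDist δ δ') c d w x y) (s : V) : δ x.1 s < d := by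
  by_contra! hle
  obtain ⟨a, ha, -⟩ := hδ.exists_between x.1 s d hle
  exact (h.sphere hδ hδ' hc (z := (a, x.2)) (by simp [prodDist, ha, hδ'.self])).1.snd_ne hδ hδ' hc
    rfl

lemma Linked.dist_snd_lt [Nontrivial V] [Nontrivial W] (hδ : IsMedianMetric δ)
    (hδ' : IsMedianMetric δ') (hc : RainbowFree (prodDist δ δ') c) {x y : V × W}
    (h : Linked (prodDist δ δ') c d w x y) (t : W) : δ' x.2 t < d :=
  h.swap.dist_fst_lt hδ' hδ hc.swap t

lemma Linked.color_ne_ends {x y : V × W} (h : Linked (prodDist δ δ') c d w x y) :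
    c x ≠ w ∧ w ≠ c y ∧ c x ≠ c y := by
  obtain ⟨m, hm, rfl⟩ := h
  exact hm.2.1.2

lemma Linked.le_of_rainbowBetween {x y x' m' y' : V × W} (h : Linked (prodDist δ δ') c d w x y)
    (h' : RainbowBetween (prodDist δ δ') c x' m' y') : d ≤ prodDist δ δ' x' y' :=
  h.elim fun _ hm ↦ hm.1.2.2 _ _ _ h'

lemma Linked.dist_lt_of_color [Nontrivial V] [Nontrivial W] (hδ : IsMedianMetric δ)
    (hδ' : IsMedianMetric δ') (hc : RainbowFree (prodDist δ δ') c) {x y g : V × W}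
    (h : Linked (prodDist δ δ') c d w x y) (hgy : c g ≠ c y) (hgw : c g ≠ w) :
    prodDist δ δ' x g < d := by
  by_contra! hle
  have hp := hδ.prod hδ'
  have l1 := h.dist_fst_lt hδ hδ' hc g.1
  have l2 := h.dist_snd_lt hδ hδ' hc g.2
  simp only [prodDist] at hle
  -- On the way to `g`, the point `(g.1, t)` is at distance `d` from `x`, and `(g.1, t₁)` is the
  -- inner point just before it. With `g` they form a three-colored geodesic inside a fiber, too
  -- short by `Linked.dist_snd_lt`.
  obtain ⟨t, ht, ht'⟩ := hδ'.exists_between x.2 g.2 (d - δ x.1 g.1) (by omega)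
  obtain ⟨t₁, ht₁, ht₁'⟩ := hδ'.exists_between x.2 t (d - δ x.1 g.1 - 1) (by omega)
  obtain ⟨hn, hcol⟩ := h.sphere hδ hδ' hc (z := (g.1, t)) (by simp only [prodDist]; omega)
  have s1 := hδ.self g.1
  have u1 := hδ'.triangle x.2 t₁ g.2
  have u2 := hδ'.triangle t₁ t g.2
  have e := hn.color_eq hp hc (z := (g.1, t₁)) (by simp only [prodDist]; omega)
    (by simp only [prodDist]; omega) (by simp only [prodDist]; omega)
  have := h.le_of_rainbowBetween (x' := (g.1, t₁)) (m' := (g.1, t)) (y' := g)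
    ⟨by simp only [prodDist]; omega, by rw [e, hcol]; exact h.color_ne_ends.2.1,
      by rw [hcol]; exact hgy.symm, by rw [e]; exact hgw.symm⟩
  simp only [prodDist] at this
  omega

/-- There is no fourth color. -/
lemma Linked.color_cases [Nontrivial V] [Nontrivial W] (hδ : IsMedianMetric δ)
    (hδ' : IsMedianMetric δ') (hc : RainbowFree (prodDist δ δ') c) {x y : V × W}
    (h : Linked (prodDist δ δ') c d w x y) (g : V × W) : c g = c x ∨ c g = c y ∨ c g = w := by
  by_contra! hg
  have hp := hδ.prod hδ'
  have l1 := h.dist_lt_of_color hδ hδ' hc hg.2.1 hg.2.2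
  have l2 := (h.symm hp).dist_lt_of_color hδ hδ' hc hg.1 hg.2.2
  -- Since `g` is nearer than `d` to both ends, this median is an inner point of color `w`, and `x,
  -- n, g` is a shorter triple.
  obtain ⟨n, n1, n2, n3⟩ := hp.exists_median x y g
  have hd := h.dist_eq
  have c1 := hp.comm y n
  have c2 := hp.comm n x
  have e : c n = w := h.color_eq hp hc (by omega) (by omega) (by omega)
  have := h.le_of_rainbowBetween (x' := x) (m' := n) (y' := g)
    ⟨n3, by rw [e]; exact h.color_ne_ends.1, by rw [e]; exact hg.2.2.symm, hg.1.symm⟩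
  omega

end Product

/-! ### Diametral pairs and farthest points in a tree. -/

section TreeMetric

variable {V : Type*} {δ : V → V → ℕ} {D : ℕ}

lemma IsTreeMetric.le_max_of_diametral (hδ : IsTreeMetric δ) (hD : ∀ a b, δ a b ≤ D) {p q : V}
    (hpq : δ p q = D) (a z : V) : δ a z ≤ max (δ a p) (δ a q) := by
  have h := hδ.four_point a z p q
  have h1 := hD z p
  have h2 := hD z q
  omega

/-- A point of a tree farthest from some given point is peripheral. -/
lemma IsTreeMetric.exists_dist_eq_of_farthest (hδ : IsTreeMetric δ) (hD : ∀ a b, δ a b ≤ D)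
    {p q : V} (hpq : δ p q = D) {t b : V} (hb : ∀ z, δ t z ≤ δ t b) : ∃ z, δ b z = D := by
  have h := hδ.four_point t b p q
  have h1 := hD b p
  have h2 := hD b q
  have h3 := hb p
  have h4 := hb q
  by_cases h5 : δ b p = D
  · exact ⟨p, h5⟩
  · exact ⟨q, by omega⟩

end TreeMetric

/-! ### Conditions on the factors that exclude or bound a shortest three-colored geodesic. -/

section Contradictions

variable {V W C : Type*} [Nontrivial V] [Nontrivial W] {δ : V → V → ℕ} {δ' : W → W → ℕ}
  {c : V × W → C} {d D D' : ℕ} {w : C}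

/-- Lift `p` and `q` to the sphere about `x` at one height `t`. Moving from `(q, t)` back towards
the height of `x` reaches a point at distance `d` from `(p, t)`: it must have the color of `x`, yet
it is an inner point of a geodesic from `x` to `(q, t)`. -/
lemma Linked.false_of_two_farthest (hδ : IsTreeMetric δ) (hδ' : IsTreeMetric δ')
    (hc : RainbowFree (prodDist δ δ') c) {x y : V × W} (h : Linked (prodDist δ δ') c d w x y)
    {p q : V} (hpq : p ≠ q) (h1 : δ x.1 p = δ x.1 q) (h2 : ∀ z, δ x.1 z ≤ δ x.1 p)
    (h3 : δ x.1 p ≤ δ p q) : False := by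
  have hδ := hδ.toIsMedianMetric
  have hδ' := hδ'.toIsMedianMetric
  have hp := hδ.prod hδ'
  have hd := h.dist_eq
  have l1 := h.dist_fst_lt hδ hδ' hc p
  have h2' := h2 y.1
  have hpq0 : δ p q ≠ 0 := fun h0 ↦ hpq (hδ.eq_of_zero h0)
  simp only [prodDist] at hd
  obtain ⟨t, ht, -⟩ := hδ'.exists_between x.2 y.2 (d - δ x.1 p) (by omega)
  obtain ⟨hl₁, e₁⟩ := h.sphere hδ hδ' hc (z := (p, t)) (by simp only [prodDist]; omega)
  obtain ⟨hl₂, e₂⟩ := h.sphere hδ hδ' hc (z := (q, t)) (by simp only [prodDist]; omega)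
  have l2 : δ p q < d := (hl₁.symm hp).dist_fst_lt hδ hδ' hc q
  have ct := hδ'.comm t x.2
  obtain ⟨t', ht', ht''⟩ := hδ'.exists_between t x.2 (d - δ p q) (by omega)
  obtain ⟨-, e₃⟩ := (hl₁.symm hp).sphere hδ hδ' hc (z := (q, t')) (by simp only [prodDist]; omega)
  have s := hδ.self q
  have ct' := hδ'.comm t t'
  have ct'' := hδ'.comm t' x.2
  exact hl₂.color_ne hp hc (z := (q, t')) (by simp only [prodDist]; omega)
    (by simp only [prodDist]; omega) (by simp only [prodDist]; omega) e₃

/-- The first factor is not `3`-peripheral. -/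
lemma Linked.false_of_threePeripheral (hδ : IsTreeMetric δ) (hδ' : IsTreeMetric δ')
    (hc : RainbowFree (prodDist δ δ') c) {x y : V × W} (h : Linked (prodDist δ δ') c d w x y)
    (hD : ∀ a b, δ a b ≤ D) {p q r : V} (hpq : δ p q = D) (hpr : δ p r = D) (hqr : δ q r = D)
    (hne : p ≠ q) : False := by
  have hD0 : D ≠ 0 := by
    rintro rfl; exact hne (hδ.eq_of_zero hpq)
  have hpr' : p ≠ r := by
    rintro rfl; rw [hδ.self] at hpr; omega
  have hqr' : q ≠ r := by
    rintro rfl; rw [hδ.self] at hqr; omega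
  have m1 := hδ.le_max_of_diametral hD hpq x.1
  have m2 := hδ.le_max_of_diametral hD hpr x.1
  have m3 := hδ.le_max_of_diametral hD hqr x.1
  have m1' := m1 r
  have m2' := m2 q
  have m3' := m3 p
  have d1 := hD x.1 p
  have d2 := hD x.1 q
  -- By the four-point condition the two largest of the three distances from `x.1` coincide, and no
  -- point is farther.
  by_cases h1 : δ x.1 p = δ x.1 q ∧ δ x.1 r ≤ δ x.1 p
  · exact h.false_of_two_farthest hδ hδ' hc hne h1.1 (fun z ↦ by have := m1 z; omega) (by omega)
  by_cases h2 : δ x.1 p = δ x.1 r ∧ δ x.1 q ≤ δ x.1 p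
  · exact h.false_of_two_farthest hδ hδ' hc hpr' h2.1 (fun z ↦ by have := m2 z; omega) (by omega)
  · exact h.false_of_two_farthest hδ hδ' hc hqr' (by omega)
      (fun z ↦ by have := m3 z; omega) (by omega)

/-- If the first factor is a single edge, then `d` is the diameter of the product. -/
lemma Linked.eq_of_dist_le_one (hδ : IsTreeMetric δ) (hδ' : IsTreeMetric δ')
    (hc : RainbowFree (prodDist δ δ') c) {x y : V × W} (h : Linked (prodDist δ δ') c d w x y)
    (hD : ∀ a b, δ a b ≤ 1) (hD' : ∀ a b, δ' a b ≤ D') {p q : W} (hpq : δ' p q = D') :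
    d = 1 + D' := by
  have hp := hδ.toIsMedianMetric.prod hδ'.toIsMedianMetric
  have h1 : δ x.1 y.1 ≠ 0 := fun h0 ↦
    h.fst_ne hδ.toIsMedianMetric hδ'.toIsMedianMetric hc (hδ.eq_of_zero h0)
  have h2 := hD x.1 y.1
  have hd := h.dist_eq
  simp only [prodDist] at hd
  -- The second coordinates are at distance `d - 1`, the largest possible by `Linked.dist_snd_lt`,
  -- so `y.2` is peripheral.
  obtain ⟨z, hz⟩ := hδ'.exists_dist_eq_of_farthest hD' hpq (t := x.2) (b := y.2) fun z ↦ by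
    have := h.dist_snd_lt hδ.toIsMedianMetric hδ'.toIsMedianMetric hc z
    omega
  have h3 := (h.symm hp).dist_snd_lt hδ.toIsMedianMetric hδ'.toIsMedianMetric hc z
  have h4 := hD' x.2 y.2
  omega

/-- If `d` is less than the diameter of the product, then, for each diametral pair of the first
factor, there is an end of a shortest three-colored geodesic over one of the two points of the pair
and over a point of the second factor of sufficiently large eccentricity. -/
lemma Linked.exists_over_diametral (hδ : IsTreeMetric δ) (hδ' : IsTreeMetric δ')
    (hc : RainbowFree (prodDist δ δ') c) {x y : V × W} (h : Linked (prodDist δ δ') c d w x y)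
    (hD : ∀ a b, δ a b ≤ D) (hD' : ∀ a b, δ' a b ≤ D') {p q : V} (hpq : δ p q = D)
    {p' q' : W} (hpq' : δ' p' q' = D') (hd : d < D + D') :
    ∃ u v t t' y, δ u v = D ∧ ({u, v} : Set V) = {p, q} ∧ d + 1 ≤ D + δ' t t' ∧
      Linked (prodDist δ δ') c d w (u, t) y := by
  have hp := hδ.toIsMedianMetric.prod hδ'.toIsMedianMetric
  wlog hfar : δ x.1 q ≤ δ x.1 p generalizing p q
  · obtain ⟨u, v, t, t', y', h1, h2, h3⟩ := this (p := q) (q := p) (by rw [hδ.comm, hpq]) (by omega)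
    exact ⟨u, v, t, t', y', h1, by rw [h2, Set.pair_comm], h3⟩
  have hfar' : ∀ z, δ x.1 z ≤ δ x.1 p := fun z ↦ by
    have := hδ.le_max_of_diametral hD hpq x.1 z; omega
  have hdxy := h.dist_eq
  have hy := hfar' y.1
  have l1 := h.dist_fst_lt hδ.toIsMedianMetric hδ'.toIsMedianMetric hc p
  simp only [prodDist] at hdxy
  obtain ⟨t, ht, -⟩ := hδ'.exists_between x.2 y.2 (d - δ x.1 p) (by omega)
  have hl := (h.sphere hδ.toIsMedianMetric hδ'.toIsMedianMetric hc (z := (p, t))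
    (by simp only [prodDist]; omega)).1.symm hp
  by_cases hex : ∃ t', d + 1 ≤ D + δ' t t'
  · obtain ⟨t', ht'⟩ := hex
    exact ⟨p, q, t, t', x, hpq, rfl, ht', hl⟩
  · push Not at hex
    have c1 := hδ'.comm t x.2
    have h1 := hD x.1 p
    have h2 := hex x.2
    -- Now `x.2` is farthest from `t`, hence peripheral, and `x.1` is at distance `D` from `p`; the
    -- point `(q, x.2)` serves as the end instead.
    obtain ⟨z, hz⟩ := hδ'.exists_dist_eq_of_farthest hD' hpq' (t := t) (b := x.2) fun z ↦ by
      have := hex z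
      omega
    refine ⟨q, p, x.2, z, (p, t), by rw [hδ.comm, hpq], Set.pair_comm _ _, by omega, ?_⟩
    exact (hl.sphere hδ.toIsMedianMetric hδ'.toIsMedianMetric hc (z := (q, x.2))
      (by simp only [prodDist]; omega)).1.symm hp

/-- If `d` were smaller, an end `(a, t)` would have both `(a', t₁)` and `(u, t₂)` on its sphere. The
point `(a', t)` is on the sphere about `(u, t₂)` and also inner to a geodesic from `(a, t)` to `(a',
t₁)`. -/
lemma Linked.le_of_even_weak (hδ : IsTreeMetric δ) (hδ' : IsTreeMetric δ')
    (hc : RainbowFree (prodDist δ δ') c) {x y : V × W} (h : Linked (prodDist δ δ') c d w x y)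
    (hD : ∀ a b, δ a b ≤ D) (hD' : ∀ a b, δ' a b ≤ D') {p q u : V} (hpq : δ p q = D)
    {p' q' : W} (hpq' : δ' p' q' = D') (hp : δ u p + 1 = D) (hq : δ u q + 1 = D) :
    D + D' ≤ d := by
  by_contra! hd
  have hpr := hδ.toIsMedianMetric.prod hδ'.toIsMedianMetric
  obtain ⟨a, a', t, t', z, ha, hset, ht, hl⟩ :=
    h.exists_over_diametral hδ hδ' hc hD hD' hpq hpq' hd
  have mem (v : V) (hv : v ∈ ({a, a'} : Set V)) : δ u v + 1 = D := by
    rw [hset] at hv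
    rcases hv with rfl | rfl <;> assumption
  have hua := mem a (by simp)
  have hua' := mem a' (by simp)
  have ca := hδ.comm u a
  have ct := hδ'.self t
  have ca' := hδ.self a'
  have l1 : δ a a' < d := hl.dist_fst_lt hδ.toIsMedianMetric hδ'.toIsMedianMetric hc a'
  obtain ⟨t₁, ht₁, -⟩ := hδ'.exists_between t t' (d - D) (by omega)
  obtain ⟨t₂, ht₂, -⟩ := hδ'.exists_between t t' (d - D + 1) (by omega)
  have ct₂ := hδ'.comm t t₂
  have h1 := (hl.sphere hδ.toIsMedianMetric hδ'.toIsMedianMetric hc (z := (a', t₁))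
    (by simp only [prodDist]; omega)).1
  have h2 := (hl.sphere hδ.toIsMedianMetric hδ'.toIsMedianMetric hc (z := (u, t₂))
    (by simp only [prodDist]; omega)).1
  have h3 := ((h2.symm hpr).sphere hδ.toIsMedianMetric hδ'.toIsMedianMetric hc (z := (a', t))
    (by simp only [prodDist]; omega)).2
  exact h1.color_ne hpr hc (by simp only [prodDist]; omega) (by simp only [prodDist]; omega)
    (by simp only [prodDist]; omega) h3

/-- The conflict is at `(a', t)`: it is on the sphere about `(b, t₁)` and inner to a geodesic from
`(a, t)` to `(a', t₂)`. The bound `2 ≤ D` keeps `a'` different from `a`. -/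
lemma Linked.le_of_odd_weak (hδ : IsTreeMetric δ) (hδ' : IsTreeMetric δ')
    (hc : RainbowFree (prodDist δ δ') c) {x y : V × W} (h : Linked (prodDist δ δ') c d w x y)
    (hD : ∀ a b, δ a b ≤ D) (hD' : ∀ a b, δ' a b ≤ D') {p q : V} (hpq : δ p q = D)
    {p' q' : W} (hpq' : δ' p' q' = D') (hD2 : 2 ≤ D)
    (hweak : ∀ u v, δ u v = D → ∃ u', δ u u' + 1 = D ∧ δ v u' = D) :
    D + D' ≤ d := by
  by_contra! hd
  have hpr := hδ.toIsMedianMetric.prod hδ'.toIsMedianMetric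
  obtain ⟨a, b, t, t', z, ha, -, ht, hl⟩ :=
    h.exists_over_diametral hδ hδ' hc hD hD' hpq hpq' hd
  obtain ⟨a', ha', hb⟩ := hweak a b ha
  have ca' := hδ.self a'
  have ct := hδ'.self t
  have l1 : δ a b < d := hl.dist_fst_lt hδ.toIsMedianMetric hδ'.toIsMedianMetric hc b
  obtain ⟨t₁, ht₁, -⟩ := hδ'.exists_between t t' (d - D) (by omega)
  obtain ⟨t₂, ht₂, -⟩ := hδ'.exists_between t t' (d - D + 1) (by omega)
  have ct₁ := hδ'.comm t t₁
  have h1 := (hl.sphere hδ.toIsMedianMetric hδ'.toIsMedianMetric hc (z := (b, t₁))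
    (by simp only [prodDist]; omega)).1
  have h2 := (hl.sphere hδ.toIsMedianMetric hδ'.toIsMedianMetric hc (z := (a', t₂))
    (by simp only [prodDist]; omega)).1
  have h3 := ((h1.symm hpr).sphere hδ.toIsMedianMetric hδ'.toIsMedianMetric hc (z := (a', t))
    (by simp only [prodDist]; omega)).2
  exact h2.color_ne hpr hc (by simp only [prodDist]; omega) (by simp only [prodDist]; omega)
    (by simp only [prodDist]; omega) h3

end Contradictions

/-! ### A rainbow-free coloring from two sets that are spheres about each other. -/

section Coloring

variable {X : Type*} {δ : X → X → ℕ}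

/-- Two sets `R` and `B` such that each is the sphere of a fixed odd radius about all points of the
other are the first two classes of a rainbow-free coloring. -/
lemma exists_rainbowFree_of_spheres (hcomm : ∀ x y, δ x y = δ y x) (hself : ∀ x, δ x x = 0)
    (heven : ∀ x y z, Even (δ x y + δ y z + δ x z)) {R B : Set X} {e : ℕ} (he : Odd e)
    (hR : ∀ r ∈ R, ∀ z, δ r z = e ↔ z ∈ B) (hB : ∀ b ∈ B, ∀ z, δ b z = e ↔ z ∈ R)
    {r b w : X} (hr : r ∈ R) (hb : b ∈ B) (hwR : w ∉ R) (hwB : w ∉ B) :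
    ∃ c : X → Fin 3, Function.Surjective c ∧ RainbowFree δ c := by
  classical
  have hdisj : ∀ x ∈ R, x ∉ B := fun x hx hx' ↦ by
    have := (hR x hx x).2 hx'
    rw [hself] at this
    subst this
    exact absurd he (by decide)
  -- A progression from `R` to `B` would be a triangle of perimeter `2 * δ x y + e`, which is odd.
  have hRB : ∀ x y z, δ x y = δ y z → x ∈ R → z ∉ B := fun x y z h hx hz ↦ by
    have h1 := (hR x hx z).2 hz
    have h2 := heven x y z
    rw [h, h1, Nat.even_iff] at h2
    rw [Nat.odd_iff] at he
    omega
  refine ⟨fun x ↦ if x ∈ R then 0 else if x ∈ B then 1 else 2, ?_, ?_⟩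
  · intro i
    fin_cases i
    · exact ⟨r, by simp [hr]⟩
    · exact ⟨b, by simp [hb, show b ∉ R from fun h ↦ hdisj b h hb]⟩
    · exact ⟨w, by simp [hwR, hwB]⟩
  · intro x y z h hxy hyz
    have k1 := hRB x y z h
    have k2 := hRB z y x (by rw [hcomm z, hcomm y x, h])
    have k3 := hdisj x
    have k4 := hdisj y
    have k5 := hdisj z
    have k6 : y ∈ R → (x ∈ B ↔ z ∈ B) := fun hy ↦ by
      rw [← hR y hy, ← hR y hy, ← h, hcomm]
    have k7 : y ∈ B → (x ∈ R ↔ z ∈ R) := fun hy ↦ by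
      rw [← hB y hy, ← hB y hy, ← h, hcomm]
    clear hRB hdisj hR hB heven hcomm hself h he hr hb hwR hwB
    dsimp only at hxy hyz ⊢
    split_ifs at hxy hyz ⊢ <;>
      first | rfl | exact absurd rfl hxy | exact absurd rfl hyz | (clear hxy hyz; exfalso; tauto)

end Coloring

/-! ### End pairs and the colorings built from them. -/

section Ends

variable {V W : Type*} {D D' : ℕ} {δ' : W → W → ℕ} {δ : V → V → ℕ}

/-- A diametral pair `p, q` in a tree of diameter `D` that is not `3`-peripheral. -/
structure IsEndPair (δ : V → V → ℕ) (D : ℕ) (p q : V) : Prop where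
  dist_le : ∀ a b, δ a b ≤ D
  dist_eq : δ p q = D
  not_both : ∀ r, δ r p = D → δ r q ≠ D

/-- An end pair `p, q` in a tree such that the points at distance `D - 1` from `p` are not
peripheral and not at distance `D - 1` from `q`. -/
structure IsStrongEndPair (δ : V → V → ℕ) (D : ℕ) (p q : V) : Prop extends
    IsEndPair δ D p q where
  dist_lt : ∀ t, δ t p + 1 = D → ∀ z, δ t z < D
  dist_ne : ∀ t, δ t p + 1 = D → δ t q + 1 ≠ D

lemma IsEndPair.symm (hδ : IsTreeMetric δ) {p q : V} (h : IsEndPair δ D p q) :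
    IsEndPair δ D q p :=
  ⟨h.dist_le, by rw [hδ.comm, h.dist_eq], fun r h1 h2 ↦ h.not_both r h2 h1⟩

/-- By the four-point condition every diameter joins the side of `p` to the side of `q`, and the
sides are disjoint. Hence all points on one side have the same antipodes. -/
lemma IsEndPair.dist_eq_iff (hδ : IsTreeMetric δ) {p q s : V} (h : IsEndPair δ D p q)
    (hs : δ s q = D) (z : V) : δ s z = D ↔ δ z p = D := by
  have h1 := h.dist_eq
  have h2 := h.dist_le s p
  have h3 := h.dist_le z p
  have h4 := h.dist_le z q
  have h5 := h.dist_le s z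
  have h6 : δ s p ≠ D := fun h' ↦ h.not_both s h' hs
  constructor
  · intro hz
    have := hδ.four_point s z p q
    omega
  · intro hz
    have h7 := h.not_both z hz
    have := hδ.four_point s q z p
    have := hδ.comm z q
    have := hδ.comm z p
    have := hδ.comm q p
    omega

lemma IsStrongEndPair.dist_add_one_eq_iff (hδ : IsTreeMetric δ) {p q s : V}
    (h : IsStrongEndPair δ D p q) (hs : δ s q = D) (z : V) : δ s z + 1 = D ↔ δ z p + 1 = D := by
  have h1 := h.dist_eq
  have h2 := h.dist_le s p
  have h3 := h.dist_le z p
  have h4 := h.dist_le z q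
  have h6 : δ s p ≠ D := fun h' ↦ h.not_both s h' hs
  have h7 := h.dist_eq_iff hδ hs z
  constructor
  · intro hz
    have h8 : δ s p + 1 ≠ D := fun h' ↦ by
      have := h.dist_lt s h' q
      omega
    have := hδ.four_point s z p q
    omega
  · intro hz
    have h8 := h.dist_lt z hz s
    have h9 := h.dist_lt z hz q
    have := hδ.four_point z p s q
    have := hδ.comm z s
    have := hδ.comm p s
    omega

lemma IsStrongEndPair.dist_add_one_eq_iff' (hδ : IsTreeMetric δ) {p q t : V}
    (h : IsStrongEndPair δ D p q) (ht : δ t p + 1 = D) (z : V) : δ t z + 1 = D ↔ δ z q = D := by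
  constructor
  · intro hz
    have h1 := h.dist_eq
    have h2 := h.dist_lt t ht q
    have h3 := h.dist_ne t ht
    have h4 := h.dist_le z p
    have h5 := h.dist_le z q
    have := hδ.four_point t z p q
    omega
  · intro hz
    rw [hδ.comm, h.dist_add_one_eq_iff hδ hz, ht]

lemma even_perimeter_prodDist (hδ : IsTreeMetric δ) (hδ' : IsTreeMetric δ') (x y z : V × W) :
    Even (prodDist δ δ' x y + prodDist δ δ' y z + prodDist δ δ' x z) := by
  obtain ⟨k, hk⟩ := hδ.even_perimeter x.1 y.1 z.1
  obtain ⟨l, hl⟩ := hδ'.even_perimeter x.2 y.2 z.2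
  exact ⟨k + l, by simp only [prodDist]; omega⟩

/-- A rainbow-free coloring for factors that are not `3`-peripheral, if the diameter of the product
is odd. -/
lemma exists_rainbowFree_of_odd (hδ : IsTreeMetric δ) (hδ' : IsTreeMetric δ')
    (hodd : Odd (D + D')) {p q : V} (h : IsEndPair δ D p q) {p' q' : W}
    (h' : IsEndPair δ' D' p' q') (hD : D ≠ 0) (hD' : D' ≠ 0) :
    ∃ c : V × W → Fin 3, Function.Surjective c ∧ RainbowFree (prodDist δ δ') c := by
  have hp := hδ.toIsMedianMetric.prod hδ'.toIsMedianMetric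
  refine exists_rainbowFree_of_spheres hp.comm hp.self (even_perimeter_prodDist hδ hδ') hodd
    (R := {x | δ x.1 q = D ∧ δ' x.2 q' = D'}) (B := {x | δ x.1 p = D ∧ δ' x.2 p' = D'})
    (r := (p, p')) (b := (q, q')) (w := (p, q')) ?_ ?_ ?_ ?_ ?_ ?_
  · rintro r ⟨h1, h2⟩ z
    have k1 := h.dist_eq_iff hδ h1 z.1
    have k2 := h'.dist_eq_iff hδ' h2 z.2
    have k3 := h.dist_le r.1 z.1
    have k4 := h'.dist_le r.2 z.2
    simp only [prodDist, Set.mem_ofPred_eq]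
    omega
  · rintro r ⟨h1, h2⟩ z
    have k1 := (h.symm hδ).dist_eq_iff hδ h1 z.1
    have k2 := (h'.symm hδ').dist_eq_iff hδ' h2 z.2
    have k3 := h.dist_le r.1 z.1
    have k4 := h'.dist_le r.2 z.2
    simp only [prodDist, Set.mem_ofPred_eq]
    omega
  · exact ⟨h.dist_eq, h'.dist_eq⟩
  · exact ⟨(h.symm hδ).dist_eq, (h'.symm hδ').dist_eq⟩
  · rintro ⟨-, h2⟩
    exact hD' (h2.symm.trans (hδ'.self _))
  · rintro ⟨h1, -⟩
    exact hD (h1.symm.trans (hδ.self _))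

/-- A rainbow-free coloring for factors with strong end pairs, if the diameter of the product is
even. -/
lemma exists_rainbowFree_of_even (hδ : IsTreeMetric δ) (hδ' : IsTreeMetric δ')
    (heven : Even (D + D')) {p q : V} (h : IsStrongEndPair δ D p q) {p' q' : W}
    (h' : IsStrongEndPair δ' D' p' q') (hD : D ≠ 0) (hD' : D' ≠ 0) :
    ∃ c : V × W → Fin 3, Function.Surjective c ∧ RainbowFree (prodDist δ δ') c := by
  have hp := hδ.toIsMedianMetric.prod hδ'.toIsMedianMetric
  have hq := (h.toIsEndPair.symm hδ).dist_eq
  have hq' := (h'.toIsEndPair.symm hδ').dist_eq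
  have hodd : Odd (D + D' - 1) := by
    obtain ⟨k, hk⟩ := heven
    exact ⟨k - 1, by omega⟩
  obtain ⟨t, ht, -⟩ := hδ'.exists_between p' q' (D' - 1) (by rw [h'.dist_eq]; omega)
  have hself := hδ.self p
  have hself' := hδ'.self q'
  -- The points of `B` fall short of being antipodal to `R` by one step, in exactly one coordinate,
  -- so that the radius is odd.
  refine exists_rainbowFree_of_spheres hp.comm hp.self (even_perimeter_prodDist hδ hδ') hodd
    (R := {x | δ x.1 q = D ∧ δ' x.2 q' = D'})
    (B := {x | (δ x.1 p = D ∧ δ' x.2 p' + 1 = D') ∨ (δ x.1 p + 1 = D ∧ δ' x.2 p' = D')})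
    (r := (p, p')) (b := (q, t)) (w := (p, q')) ?_ ?_ ?_ ?_ ?_ ?_
  · rintro r ⟨h1, h2⟩ z
    have k1 := h.toIsEndPair.dist_eq_iff hδ h1 z.1
    have k2 := h'.toIsEndPair.dist_eq_iff hδ' h2 z.2
    have k3 := h.dist_add_one_eq_iff hδ h1 z.1
    have k4 := h'.dist_add_one_eq_iff hδ' h2 z.2
    have k5 := h.dist_le r.1 z.1
    have k6 := h'.dist_le r.2 z.2
    simp only [prodDist, Set.mem_ofPred_eq]
    omega
  · rintro b (⟨h1, h2⟩ | ⟨h1, h2⟩) z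
    · have k1 := (h.toIsEndPair.symm hδ).dist_eq_iff hδ h1 z.1
      have k2 := h'.dist_add_one_eq_iff' hδ' h2 z.2
      have k3 := h.dist_le b.1 z.1
      have k4 := h'.dist_lt b.2 h2 z.2
      simp only [prodDist, Set.mem_ofPred_eq]
      omega
    · have k1 := h.dist_add_one_eq_iff' hδ h1 z.1
      have k2 := (h'.toIsEndPair.symm hδ').dist_eq_iff hδ' h2 z.2
      have k3 := h.dist_lt b.1 h1 z.1
      have k4 := h'.dist_le b.2 z.2
      simp only [prodDist, Set.mem_ofPred_eq]
      omega
  · exact ⟨h.dist_eq, h'.dist_eq⟩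
  · exact Or.inl ⟨hq, by rw [hδ'.comm]; dsimp only; omega⟩
  · rintro ⟨-, h2⟩
    dsimp only at h2
    omega
  · rintro (⟨h1, -⟩ | ⟨h1, -⟩) <;> dsimp only at h1
    · omega
    · have := h.dist_lt p h1 q
      rw [h.dist_eq] at this
      omega

end Ends

/-! ### Translation between graph notions and distances. -/

section Graph

variable {V W : Type*} {T : SimpleGraph V} {T' : SimpleGraph W}

lemma dist_le_diam_of_finite [Finite V] (hT : T.Connected) (a b : V) : T.dist a b ≤ T.diam :=
  have := hT.nonempty
  SimpleGraph.dist_le_diam (SimpleGraph.connected_iff_ediam_ne_top.1 hT)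

lemma diam_ne_zero_of_connected [Finite V] [Nontrivial V] (hT : T.Connected) : T.diam ≠ 0 :=
  SimpleGraph.connected_iff_diam_ne_zero.1 hT

lemma diam_eq_of_dist_le [Finite V] (hT : T.Connected) {n : ℕ} (h : ∀ a b, T.dist a b ≤ n)
    {p q : V} (hpq : T.dist p q = n) : T.diam = n := by
  have := hT.nonempty
  obtain ⟨u, v, huv⟩ := T.exists_dist_eq_diam
  have h1 := h u v
  have h2 := dist_le_diam_of_finite hT p q
  omega

lemma isPeripheralVertex_of_dist [Finite V] (hT : T.Connected) {p q : V}
    (h : T.dist p q = T.diam) : IsPeripheralVertex T p := by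
  have := hT.nonempty
  refine le_antisymm SimpleGraph.eccent_le_ediam ?_
  have h1 : T.ediam = (T.diam : ℕ∞) :=
    (ENat.natCast_toNat (SimpleGraph.connected_iff_ediam_ne_top.1 hT)).symm
  rw [h1, ← h, (hT p q).coe_dist_eq_edist]
  exact SimpleGraph.edist_le_eccent

lemma IsPeripheralVertex.exists_dist_eq [Finite V] {p : V} (h : IsPeripheralVertex T p) :
    ∃ q, T.dist p q = T.diam := by
  obtain ⟨q, hq⟩ := T.exists_edist_eq_eccent_of_finite p
  exact ⟨q, by rw [SimpleGraph.dist, SimpleGraph.diam, hq, h]⟩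

lemma isPeripheral_three_iff : IsPeripheral 3 T ↔ ∃ p q r : V, p ≠ q ∧ p ≠ r ∧ q ≠ r ∧
    T.dist p q = T.diam ∧ T.dist p r = T.diam ∧ T.dist q r = T.diam := by
  constructor
  · rintro ⟨u, hu, h⟩
    exact ⟨u 0, u 1, u 2, hu.ne (by decide), hu.ne (by decide), hu.ne (by decide),
      h 0 1 (by decide), h 0 2 (by decide), h 1 2 (by decide)⟩
  · rintro ⟨p, q, r, hpq, hpr, hqr, h1, h2, h3⟩
    refine ⟨![p, q, r], ?_, ?_⟩
    · intro i j hij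
      fin_cases i <;> fin_cases j <;> simp_all
    · intro i j hij
      fin_cases i <;> fin_cases j <;> simp_all [T.dist_comm]

lemma dist_boxProd (hT : T.Connected) (hT' : T'.Connected) (x y : V × W) :
    (T.boxProd T').dist x y = prodDist T.dist T'.dist x y := by
  rw [SimpleGraph.dist, SimpleGraph.edist_boxProd, ENat.toNat_add]
  · rfl
  · exact SimpleGraph.edist_ne_top_iff_reachable.2 (hT _ _)
  · exact SimpleGraph.edist_ne_top_iff_reachable.2 (hT' _ _)

lemma diam_boxProd [Finite V] [Finite W] (hT : T.Connected) (hT' : T'.Connected) :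
    (T.boxProd T').diam = T.diam + T'.diam := by
  have := hT.nonempty
  have := hT'.nonempty
  obtain ⟨u, v, huv⟩ := T.exists_dist_eq_diam
  obtain ⟨u', v', huv'⟩ := T'.exists_dist_eq_diam
  refine diam_eq_of_dist_le (hT.boxProd hT') (fun x y ↦ ?_) (p := (u, u')) (q := (v, v')) ?_
  · rw [dist_boxProd hT hT']
    exact Nat.add_le_add (dist_le_diam_of_finite hT _ _) (dist_le_diam_of_finite hT' _ _)
  · rw [dist_boxProd hT hT', prodDist, huv, huv']

lemma hasRainbowAP_three_iff {G : SimpleGraph V} (hG : G.Connected) {r : ℕ} (c : V → Fin r) :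
    HasRainbowAP G 3 c ↔ ¬ RainbowFree G.dist c := by
  constructor
  · rintro ⟨v, ⟨d, hd⟩, hinj⟩ hc
    have h0 := hd 0 (by omega)
    have h1 := hd 1 (by omega)
    have h2 := hc (v 0) (v 1) (v 2) (by
      simp only [SimpleGraph.dist]
      exact congrArg ENat.toNat (h0.trans h1.symm))
      (hinj.ne (a₁ := 0) (a₂ := 1) (by decide)) (hinj.ne (a₁ := 1) (a₂ := 2) (by decide))
    exact hinj.ne (a₁ := 0) (a₂ := 2) (by decide) h2
  · intro h
    simp only [RainbowFree, not_forall] at h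
    obtain ⟨x, y, z, hd, hxy, hyz, hxz⟩ := h
    refine ⟨![x, y, z], ⟨G.dist x y, fun i hi ↦ ?_⟩, fun i j hij ↦ ?_⟩
    · obtain rfl | rfl : i = 0 ∨ i = 1 := by omega
      · exact (hG x y).coe_dist_eq_edist.symm
      · rw [hd]
        exact (hG y z).coe_dist_eq_edist.symm
    · fin_cases i <;> fin_cases j <;> simp_all [eq_comm]

lemma not_hasRainbowAP_three {G : SimpleGraph V} {r : ℕ} (hr : r < 3) (c : V → Fin r) :
    ¬ HasRainbowAP G 3 c := by
  rintro ⟨v, -, hinj⟩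
  have := Fintype.card_le_of_injective _ hinj
  simp at this
  omega

lemma three_le_of_forall_hasRainbowAP [Nontrivial V] {G : SimpleGraph V} {r : ℕ} (h0 : 0 < r)
    (h : ∀ c : V → Fin r, Function.Surjective c → HasRainbowAP G 3 c) : 3 ≤ r := by
  classical
  by_contra! hr
  obtain rfl | rfl : r = 1 ∨ r = 2 := by omega
  · obtain ⟨x⟩ : Nonempty V := inferInstance
    exact not_hasRainbowAP_three hr _ (h (fun _ ↦ 0) fun i ↦ ⟨x, Subsingleton.elim _ _⟩)
  · obtain ⟨x, y, hxy⟩ := exists_pair_ne V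
    refine not_hasRainbowAP_three hr _ (h (fun z ↦ if z = x then 0 else 1) fun i ↦ ?_)
    fin_cases i
    · exact ⟨x, by simp⟩
    · exact ⟨y, by simp [hxy.symm]⟩

lemma aw_eq_three [Nontrivial V] {G : SimpleGraph V}
    (h : ∀ c : V → Fin 3, Function.Surjective c → HasRainbowAP G 3 c) : aw G 3 = 3 :=
  le_antisymm (Nat.sInf_le ⟨by decide, h⟩)
    (le_csInf ⟨3, by decide, h⟩ fun _ hr ↦ three_le_of_forall_hasRainbowAP hr.1 hr.2)

lemma aw_eq_four [Nontrivial V] {G : SimpleGraph V}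
    (h : ∀ c : V → Fin 4, Function.Surjective c → HasRainbowAP G 3 c) {c : V → Fin 3}
    (hc : Function.Surjective c) (hc' : ¬ HasRainbowAP G 3 c) : aw G 3 = 4 := by
  refine le_antisymm (Nat.sInf_le ⟨by decide, h⟩) (le_csInf ⟨4, by decide, h⟩ fun r hr ↦ ?_)
  have h3 := three_le_of_forall_hasRainbowAP hr.1 hr.2
  rcases h3.eq_or_lt with rfl | h4
  · exact absurd (hr.2 c hc) hc'
  · exact h4

lemma le_add_dist_of_adj {G : SimpleGraph V} (hG : G.Connected) {φ : V → ℕ}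
    (hφ : ∀ x y, G.Adj x y → φ x ≤ φ y + 1) (x y : V) : φ x ≤ φ y + G.dist x y := by
  obtain ⟨p, hp⟩ := hG.exists_walk_length_eq_dist x y
  rw [← hp]
  clear hp
  induction p with
  | nil => simp
  | cons h p ih =>
    have := hφ _ _ h
    rw [SimpleGraph.Walk.length_cons]
    omega

end Graph

/-! ### Distances after adding a leaf. -/

section AddLeaf

variable {V : Type*} {T : SimpleGraph V}

lemma addLeaf_adj_some {u a b : V} : (addLeaf T u).Adj (some a) (some b) ↔ T.Adj a b := by
  simpa [addLeaf, SimpleGraph.edge_adj, SimpleGraph.map_adj'] using fun h ↦ h.ne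

lemma addLeaf_adj_none {u a : V} : (addLeaf T u).Adj none (some a) ↔ a = u := by
  simp [addLeaf, SimpleGraph.map_adj', SimpleGraph.edge_adj]

/-- The inclusion of `T` into `T` with a leaf added. -/
def addLeafHom (T : SimpleGraph V) (u : V) : T →g addLeaf T u where
  toFun := some
  map_rel' h := addLeaf_adj_some.2 h

lemma connected_addLeaf (hT : T.Connected) (u : V) : (addLeaf T u).Connected := by
  rw [SimpleGraph.connected_iff_exists_forall_reachable]
  refine ⟨some u, fun x ↦ ?_⟩
  cases x with
  | none => exact (addLeaf_adj_none.2 rfl).symm.reachable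
  | some a => exact (hT u a).map (addLeafHom T u)

lemma dist_addLeaf_some_some_le (hT : T.Connected) (u a b : V) :
    (addLeaf T u).dist (some a) (some b) ≤ T.dist a b := by
  obtain ⟨p, hp⟩ := hT.exists_walk_length_eq_dist a b
  rw [← hp, ← SimpleGraph.Walk.length_map (addLeafHom T u) p]
  exact SimpleGraph.dist_le _

/-- The left side, as a function of `x`, changes by at most one along each edge. -/
lemma le_dist_addLeaf (hT : T.Connected) (u b : V) (x : Option V) :
    x.elim (T.dist u b + 1) (T.dist · b) ≤ (addLeaf T u).dist x (some b) := by
  have h := le_add_dist_of_adj (connected_addLeaf hT u)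
    (φ := fun x ↦ x.elim (T.dist u b + 1) (T.dist · b)) ?_ x (some b)
  · simpa using h
  · intro x y hxy
    match x, y with
    | none, none => exact absurd hxy (addLeaf T u).irrefl
    | none, some a =>
      obtain rfl := addLeaf_adj_none.1 hxy
      simp
    | some a, none =>
      obtain rfl := addLeaf_adj_none.1 hxy.symm
      simp only [Option.elim]
      omega
    | some a, some a' =>
      have h1 := hT.dist_triangle (u := a) (v := a') (w := b)
      have h2 := SimpleGraph.dist_eq_one_iff_adj.2 (addLeaf_adj_some.1 hxy)
      simp only [Option.elim]
      omega

lemma dist_addLeaf_some_some (hT : T.Connected) (u a b : V) :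
    (addLeaf T u).dist (some a) (some b) = T.dist a b :=
  le_antisymm (dist_addLeaf_some_some_le hT u a b) (le_dist_addLeaf hT u b (some a))

lemma dist_addLeaf_none_some (hT : T.Connected) (u b : V) :
    (addLeaf T u).dist none (some b) = T.dist u b + 1 := by
  refine le_antisymm ?_ (le_dist_addLeaf hT u b none)
  have h1 := (connected_addLeaf hT u).dist_triangle (u := none) (v := some u) (w := some b)
  have h2 := SimpleGraph.dist_eq_one_iff_adj.2
    ((addLeaf_adj_none (T := T) (u := u) (a := u)).2 rfl)
  rw [dist_addLeaf_some_some hT] at h1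
  omega

/-- The new leaf must belong to the peripheral triple, since the diameter does not drop; the other
two vertices show that it does not grow either. -/
lemma exists_of_isPeripheral_addLeaf [Finite V] (hT : T.Connected) {u : V}
    (hn : ¬ IsPeripheral 3 T) (h : IsPeripheral 3 (addLeaf T u)) :
    ∃ p q, T.dist p q = T.diam ∧ T.dist u p + 1 = T.diam ∧ T.dist u q + 1 = T.diam := by
  have := hT.nonempty
  have hle : T.diam ≤ (addLeaf T u).diam := by
    obtain ⟨a, b, hab⟩ := T.exists_dist_eq_diam
    rw [← hab, ← dist_addLeaf_some_some hT u]
    exact dist_le_diam_of_finite (connected_addLeaf hT u) _ _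
  have key : ∀ p q, (addLeaf T u).dist none (some p) = (addLeaf T u).diam →
      (addLeaf T u).dist none (some q) = (addLeaf T u).diam →
      (addLeaf T u).dist (some p) (some q) = (addLeaf T u).diam →
      T.dist p q = T.diam ∧ T.dist u p + 1 = T.diam ∧ T.dist u q + 1 = T.diam := by
    intro p q h1 h2 h3
    rw [dist_addLeaf_none_some hT] at h1 h2
    rw [dist_addLeaf_some_some hT] at h3
    have := dist_le_diam_of_finite hT p q
    omega
  obtain ⟨x, y, z, hxy, hxz, hyz, h1, h2, h3⟩ := isPeripheral_three_iff.1 h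
  match x, y, z with
  | some p, some q, some r =>
    rw [dist_addLeaf_some_some hT] at h1 h2 h3
    have := dist_le_diam_of_finite hT p q
    exact absurd (isPeripheral_three_iff.2 ⟨p, q, r, by simpa using hxy, by simpa using hxz,
      by simpa using hyz, by omega, by omega, by omega⟩) hn
  | none, some p, some q => exact ⟨p, q, key p q h1 h2 h3⟩
  | some p, none, some q =>
    exact ⟨p, q, key p q (by rw [SimpleGraph.dist_comm]; exact h1) h3 h2⟩
  | some p, some q, none =>
    exact ⟨p, q, key p q (by rw [SimpleGraph.dist_comm]; exact h2)
      (by rw [SimpleGraph.dist_comm]; exact h3) h1⟩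
  | none, none, _ => exact absurd rfl hxy
  | none, some _, none => exact absurd rfl hxz
  | some _, none, none => exact absurd rfl hyz

lemma isPeripheral_addLeaf [Finite V] (hT : T.Connected) {p q u : V} (hpq : T.dist p q = T.diam)
    (hp : T.dist u p + 1 = T.diam) (hq : T.dist u q + 1 = T.diam)
    (hu : ∀ z, T.dist u z < T.diam) : IsPeripheral 3 (addLeaf T u) := by
  have hdiam : (addLeaf T u).diam = T.diam := by
    refine diam_eq_of_dist_le (connected_addLeaf hT u) (fun x y ↦ ?_) (p := some p) (q := some q)
      (by rw [dist_addLeaf_some_some hT, hpq])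
    match x, y with
    | none, none => simp
    | none, some a =>
      rw [dist_addLeaf_none_some hT]
      exact hu a
    | some a, none =>
      rw [SimpleGraph.dist_comm, dist_addLeaf_none_some hT]
      exact hu a
    | some a, some b =>
      rw [dist_addLeaf_some_some hT]
      exact dist_le_diam_of_finite hT a b
  refine isPeripheral_three_iff.2 ⟨none, some p, some q, by simp, by simp, ?_, ?_, ?_, ?_⟩
  · rintro h
    obtain rfl := Option.some_injective _ h
    rw [SimpleGraph.dist_self] at hpq
    omega
  · rw [dist_addLeaf_none_some hT, hdiam, hp]
  · rw [dist_addLeaf_none_some hT, hdiam, hq]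
  · rw [dist_addLeaf_some_some hT, hdiam, hpq]

end AddLeaf

/-! ### Distances after removing the vertices farthest from a peripheral vertex. -/

section RemoveFar

variable {V : Type*} {T : SimpleGraph V}

/-- Geodesics between kept vertices avoid the removed ones: a path that enters a vertex at distance
`T.diam` from `v` and continues would get even farther from `v`. -/
lemma exists_walk_removeFar [Finite V] (hT : T.IsTree) (v : V) (n : ℕ)
    (x y : {x : V // T.dist v x ≠ T.diam}) (h : T.dist x.1 y.1 = n) :
    ∃ p : (removeFar T v).Walk x y, p.length = n := by
  induction n generalizing x with
  | zero =>
    obtain rfl : x = y := Subtype.ext (hT.1.dist_eq_zero_iff.1 h)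
    exact ⟨.nil, rfl⟩
  | succ n ih =>
    have hne : x.1 ≠ y.1 := by
      intro h'
      rw [h', SimpleGraph.dist_self] at h
      omega
    obtain ⟨x', hadj, hd⟩ := exists_adj_dist_add_one hT.1 hne
    have hx' : T.dist v x' ≠ T.diam := by
      intro hx'
      have h1 := T.dist_comm (u := v) (v := x')
      have h2 := T.dist_comm (u := v) (v := x.1)
      have hxv := dist_le_diam_of_finite hT.1 v x.1
      have hxy := dist_le_diam_of_finite hT.1 v y.1
      have hx := x.2
      have hy := y.2
      rcases dist_cases hT hadj v with h' | h'
      · omega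
      · have := dist_add_dist_of_adj hT hadj.symm (y := v) (z := y) (by omega) (by omega)
        omega
    obtain ⟨p, hp⟩ := ih ⟨x', hx'⟩ (by dsimp only; omega)
    have hadj' : (removeFar T v).Adj x ⟨x', hx'⟩ := hadj
    exact ⟨.cons hadj' p, by rw [SimpleGraph.Walk.length_cons, hp]⟩

lemma connected_removeFar [Finite V] [Nontrivial V] (hT : T.IsTree) (v : V) :
    (removeFar T v).Connected := by
  have : Nonempty {x : V // T.dist v x ≠ T.diam} :=
    ⟨⟨v, by rw [SimpleGraph.dist_self]; exact (diam_ne_zero_of_connected hT.1).symm⟩⟩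
  exact ⟨fun x y ↦ (exists_walk_removeFar hT v _ x y rfl).elim fun p _ ↦ ⟨p⟩⟩

lemma dist_removeFar [Finite V] [Nontrivial V] (hT : T.IsTree) (v : V)
    (x y : {x : V // T.dist v x ≠ T.diam}) : (removeFar T v).dist x y = T.dist x.1 y.1 := by
  apply le_antisymm
  · obtain ⟨p, hp⟩ := exists_walk_removeFar hT v _ x y rfl
    rw [← hp]
    exact SimpleGraph.dist_le p
  · have h := le_add_dist_of_adj (connected_removeFar hT v) (φ := fun z ↦ T.dist z.1 y.1) ?_ x y
    · simpa using h
    · intro a b hab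
      have hab' : T.Adj a.1 b.1 := hab
      have h1 := hT.1.dist_triangle (u := a.1) (v := b.1) (w := y.1)
      have h2 := SimpleGraph.dist_eq_one_iff_adj.2 hab'
      omega

lemma dist_lt_of_removeFar [Finite V] (hT : T.IsTree) {u v : V}
    (huv : T.dist u v = T.diam) (x y : {x : V // T.dist u x ≠ T.diam}) :
    T.dist x.1 y.1 < T.diam := by
  have h1 := dist_le_diam_of_finite hT.1 x.1 y.1
  have h2 := four_point_dist hT x.1 y.1 u v
  have h3 := T.dist_comm (u := x.1) (v := u)
  have h4 := T.dist_comm (u := y.1) (v := u)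
  have h5 := dist_le_diam_of_finite hT.1 u x.1
  have h6 := dist_le_diam_of_finite hT.1 u y.1
  have h7 := dist_le_diam_of_finite hT.1 x.1 v
  have h8 := dist_le_diam_of_finite hT.1 y.1 v
  have h9 := x.2
  have h10 := y.2
  omega

lemma diam_removeFar [Finite V] [Nontrivial V] (hT : T.IsTree) {u v : V}
    (huv : T.dist u v = T.diam) : (removeFar T u).diam + 1 = T.diam := by
  have h0 := diam_ne_zero_of_connected hT.1
  obtain ⟨w, hw, -⟩ := exists_dist_between hT.1 u v (T.diam - 1) (by omega)
  have := diam_eq_of_dist_le (connected_removeFar hT u) (n := T.diam - 1)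
    (fun x y ↦ by
      have := dist_lt_of_removeFar hT huv x y
      rw [dist_removeFar hT]
      omega)
    (p := ⟨u, by rw [SimpleGraph.dist_self]; exact h0.symm⟩) (q := ⟨w, by omega⟩)
    (by rw [dist_removeFar hT, hw])
  omega

/-- By the four-point condition against `u, v`, each pair of the triple has one point at distance
`T.diam - 1` from `u` and the other at distance `T.diam` from `v`. With three points, some point
must have both properties. -/
lemma exists_of_isPeripheral_removeFar [Finite V] [Nontrivial V] (hT : T.IsTree) {u v : V}
    (huv : T.dist u v = T.diam) (h : IsPeripheral 3 (removeFar T u)) :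
    2 ≤ T.diam ∧ ∃ u', T.dist u u' + 1 = T.diam ∧ T.dist v u' = T.diam := by
  obtain ⟨x, y, z, hxy, hxz, hyz, h1, h2, h3⟩ := isPeripheral_three_iff.1 h
  have hd := diam_removeFar hT huv
  rw [dist_removeFar hT] at h1 h2 h3
  have hne : T.dist x.1 y.1 ≠ 0 := fun h' ↦ hxy (Subtype.ext (hT.1.dist_eq_zero_iff.1 h'))
  refine ⟨by omega, ?_⟩
  by_contra! hcon
  have bound (s : {x : V // T.dist u x ≠ T.diam}) : T.dist u s.1 < T.diam ∧
      T.dist v s.1 ≤ T.diam ∧ (T.dist u s.1 + 1 = T.diam → T.dist v s.1 ≠ T.diam) :=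
    ⟨lt_of_le_of_ne (dist_le_diam_of_finite hT.1 _ _) s.2, dist_le_diam_of_finite hT.1 _ _,
      hcon s.1⟩
  have hx := bound x
  have hy := bound y
  have hz := bound z
  have f1 := four_point_dist hT u v x.1 y.1
  have f2 := four_point_dist hT u v x.1 z.1
  have f3 := four_point_dist hT u v y.1 z.1
  omega

lemma isPeripheral_removeFar [Finite V] [Nontrivial V] (hT : T.IsTree) {u v t : V}
    (huv : T.dist u v = T.diam) (h2 : 2 ≤ T.diam) (ht : T.dist u t + 1 = T.diam)
    (htv : T.dist t v = T.diam) : IsPeripheral 3 (removeFar T u) := by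
  have hd := diam_removeFar hT huv
  -- The third point beside `u` and `t` is the neighbor of `v` towards `u`.
  obtain ⟨w, hw, hw'⟩ := exists_dist_between hT.1 u v (T.diam - 1) (by omega)
  let u₀ : {x : V // T.dist u x ≠ T.diam} := ⟨u, by rw [SimpleGraph.dist_self]; omega⟩
  let t₀ : {x : V // T.dist u x ≠ T.diam} := ⟨t, by omega⟩
  let w₀ : {x : V // T.dist u x ≠ T.diam} := ⟨w, by omega⟩
  have htw : T.dist t w < T.diam := dist_lt_of_removeFar hT huv t₀ w₀
  have htri := hT.1.dist_triangle (u := t) (v := w) (w := v)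
  have ne_of_pos {x y : {x : V // T.dist u x ≠ T.diam}} (h : T.dist x.1 y.1 ≠ 0) : x ≠ y := by
    rintro rfl
    exact h SimpleGraph.dist_self
  refine isPeripheral_three_iff.2 ⟨u₀, t₀, w₀, ne_of_pos ?_, ne_of_pos ?_, ne_of_pos ?_, ?_, ?_, ?_⟩
  all_goals (try rw [dist_removeFar hT]); dsimp only [u₀, t₀, w₀]; omega

end RemoveFar

/-! ### From failing hypotheses to strong end pairs. -/

section Translation

variable {V : Type*} {T : SimpleGraph V}

lemma dist_le_one_of_iso (f : T ≃g SimpleGraph.pathGraph 2) (a b : V) : T.dist a b ≤ 1 := by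
  by_cases hab : a = b
  · simp [hab]
  · have : (SimpleGraph.pathGraph 2).Adj (f a) (f b) := by
      have htop (i j : Fin 2) (hij : i ≠ j) : (SimpleGraph.pathGraph 2).Adj i j := by
        rw [SimpleGraph.pathGraph_two_eq_top]
        exact hij
      exact htop _ _ (f.injective.ne hab)
    exact (SimpleGraph.dist_eq_one_iff_adj.2 (f.map_rel_iff.1 this)).le

lemma nonempty_iso_of_diam_eq_one [Finite V] [Nontrivial V] (hT : T.IsTree) (h : T.diam = 1) :
    Nonempty (T ≃g SimpleGraph.pathGraph 2) := by
  have htop := SimpleGraph.diam_eq_one.1 h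
  have hdist {a b : V} (hab : a ≠ b) : T.dist a b = 1 := by
    rw [SimpleGraph.dist_eq_one_iff_adj, htop]
    exact hab
  obtain ⟨x, y, hxy⟩ := exists_pair_ne V
  have hcard : Nat.card V = 2 := by
    rw [Nat.card_eq_two_iff]
    refine ⟨x, y, hxy, Set.eq_univ_of_forall fun z ↦ ?_⟩
    by_contra! hz
    simp only [Set.mem_insert_iff, Set.mem_singleton_iff, not_or] at hz
    have := even_perimeter_dist hT x y z
    rw [hdist hxy, hdist (Ne.symm hz.1), hdist (Ne.symm hz.2)] at this
    exact absurd this (by decide)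
  rw [SimpleGraph.pathGraph_two_eq_top, htop]
  exact ⟨SimpleGraph.Iso.completeGraph (Finite.equivFinOfCardEq hcard)⟩

lemma isEndPair_of_not_isPeripheral [Finite V] [Nontrivial V] (hT : T.IsTree)
    (hn : ¬ IsPeripheral 3 T) {p q : V} (hpq : T.dist p q = T.diam) :
    IsEndPair T.dist T.diam p q := by
  have h0 := diam_ne_zero_of_connected hT.1
  have ne {x y : V} (h : T.dist x y = T.diam) : x ≠ y := by
    rintro rfl
    rw [SimpleGraph.dist_self] at h
    exact h0 h.symm
  exact ⟨dist_le_diam_of_finite hT.1, hpq, fun r h1 h2 ↦ hn (isPeripheral_three_iff.2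
    ⟨r, p, q, ne h1, ne h2, ne hpq, h1, h2, hpq⟩)⟩

/-- For even diameter any diametral pair works: parity gives `dist_lt`, and a failure of `dist_ne`
would be a place for a leaf. For odd diameter the roles are exchanged, and `p` is chosen as a vertex
whose removal condition fails. -/
lemma exists_isStrongEndPair [Finite V] [Nontrivial V] (hT : T.IsTree)
    (hn : ¬ IsPeripheral 3 T) (hP : ¬ Nonempty (T ≃g SimpleGraph.pathGraph 2))
    (hw : ¬ IsWeaklyNonThreePeripheral T) : ∃ p q, IsStrongEndPair T.dist T.diam p q := by
  simp only [IsWeaklyNonThreePeripheral, not_and, not_or] at hw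
  obtain ⟨hodd, heven⟩ := hw hn
  have hle := dist_le_diam_of_finite hT.1
  rcases Nat.even_or_odd T.diam with hD | hD
  · obtain ⟨p, q, hpq⟩ := T.exists_dist_eq_diam
    have hlt : ∀ t, T.dist t p + 1 = T.diam → ∀ z, T.dist t z < T.diam := by
      intro t ht z
      by_contra! hz
      have h1 := four_point_dist hT t z p q
      have h2 := hle z q
      have h3 := hle z p
      have h4 := hle t q
      have h5 := even_perimeter_dist hT t p q
      rw [Nat.even_iff] at h5 hD
      omega
    exact ⟨p, q, isEndPair_of_not_isPeripheral hT hn hpq, hlt, fun t hp hq ↦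
      heven hD ⟨t, isPeripheral_addLeaf hT.1 hpq hp hq (hlt t hp)⟩⟩
  · have h := hodd hD
    push Not at h
    obtain ⟨p, hp, hp'⟩ := h
    obtain ⟨q, hpq⟩ := hp.exists_dist_eq
    have h2 : 2 ≤ T.diam := by
      have h0 := diam_ne_zero_of_connected hT.1
      have h1 : T.diam ≠ 1 := fun h ↦ hP (nonempty_iso_of_diam_eq_one hT h)
      omega
    refine ⟨p, q, isEndPair_of_not_isPeripheral hT hn hpq, fun t ht z ↦ ?_, fun t ht ht' ↦ ?_⟩
    · by_contra! hz
      have h1 := four_point_dist hT t z p q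
      have h3 := hle z q
      have h4 := hle z p
      have h5 := hle t q
      exact hp' (isPeripheral_removeFar hT hpq h2 (by rw [T.dist_comm, ht]) (by omega))
    · have h5 := even_perimeter_dist hT t p q
      rw [Nat.even_iff] at h5
      rw [Nat.odd_iff] at hD
      omega

end Translation

/-! ### Rainbow progressions in the product; four colors always suffice. -/

section Product

variable {V W : Type*} {T : SimpleGraph V} {T' : SimpleGraph W}

lemma exists_linked (hT : T.IsTree) (hT' : T'.IsTree) {n : ℕ} (hn : 3 ≤ n)
    {c : V × W → Fin n} (hs : Function.Surjective c) :
    ∃ d w x y, Linked (prodDist T.dist T'.dist) c d w x y := by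
  obtain ⟨x, hx⟩ := hs ⟨0, by omega⟩
  obtain ⟨y, hy⟩ := hs ⟨1, by omega⟩
  obtain ⟨z, hz⟩ := hs ⟨2, by omega⟩
  obtain ⟨d, x, m, y, h⟩ := exists_minTriple (c := c)
    ((isTreeMetric_dist hT).toIsMedianMetric.prod (isTreeMetric_dist hT').toIsMedianMetric)
    (x := x) (y := y) (z := z) (by simp [hx, hy]) (by simp [hy, hz]) (by simp [hx, hz])
  exact ⟨d, c m, x, y, m, h, rfl⟩

lemma hasRainbowAP_boxProd_iff (hT : T.IsTree) (hT' : T'.IsTree) {n : ℕ} (c : V × W → Fin n) :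
    HasRainbowAP (T.boxProd T') 3 c ↔ ¬ RainbowFree (prodDist T.dist T'.dist) c := by
  rw [hasRainbowAP_three_iff (hT.1.boxProd hT'.1)]
  simp only [RainbowFree, dist_boxProd hT.1 hT'.1]

lemma hasRainbowAP_of_four [Nontrivial V] [Nontrivial W] (hT : T.IsTree) (hT' : T'.IsTree)
    (c : V × W → Fin 4) (hs : Function.Surjective c) : HasRainbowAP (T.boxProd T') 3 c := by
  rw [hasRainbowAP_boxProd_iff hT hT']
  intro hc
  obtain ⟨d, w, x, y, h⟩ := exists_linked hT hT' (by decide) hs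
  have hcol : (Finset.univ : Finset (Fin 4)) ⊆ {c x, c y, w} := fun i _ ↦ by
    obtain ⟨g, rfl⟩ := hs i
    simpa using h.color_cases (isTreeMetric_dist hT).toIsMedianMetric
      (isTreeMetric_dist hT').toIsMedianMetric hc g
  have h1 := Finset.card_le_card hcol
  have h2 := Finset.card_le_three (a := c x) (b := c y) (c := w)
  simp only [Finset.card_univ, Fintype.card_fin] at h1
  omega

end Product

/-! ### The dichotomy between three and four. -/

section ThreeCase

variable {V W C : Type*} [Finite V] [Finite W] [Nontrivial V] [Nontrivial W]
  {T : SimpleGraph V} {T' : SimpleGraph W}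

lemma Linked.false_of_left (hT : T.IsTree) (hT' : T'.IsTree) {c : V × W → C}
    (hc : RainbowFree (prodDist T.dist T'.dist) c) {d : ℕ} {w : C} {x y : V × W}
    (h : Linked (prodDist T.dist T'.dist) c d w x y)
    (hcase : IsPeripheral 3 T ∨ Even (T.diam + T'.diam) ∧
      (Nonempty (T ≃g SimpleGraph.pathGraph 2) ∨ IsWeaklyNonThreePeripheral T)) : False := by
  have hδ := isTreeMetric_dist hT
  have hδ' := isTreeMetric_dist hT'
  have hD := dist_le_diam_of_finite hT.1
  have hD' := dist_le_diam_of_finite hT'.1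
  have hodd := h.odd (hδ.toIsMedianMetric.prod hδ'.toIsMedianMetric) hc
  obtain ⟨p', q', hpq'⟩ := T'.exists_dist_eq_diam
  -- The odd number `d` cannot equal an even diameter.
  have hlt : Even (T.diam + T'.diam) → d < T.diam + T'.diam := fun he ↦ by
    have h1 := h.dist_eq
    have h2 := hD x.1 y.1
    have h3 := hD' x.2 y.2
    rw [prodDist] at h1
    rw [Nat.even_iff] at he
    rw [Nat.odd_iff] at hodd
    omega
  rcases hcase with hper | ⟨heven, ⟨⟨f⟩⟩ | ⟨hn, ⟨-, hw⟩ | ⟨-, v, hv⟩⟩⟩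
  · obtain ⟨p, q, r, hne, -, -, h1, h2, h3⟩ := isPeripheral_three_iff.1 hper
    exact h.false_of_threePeripheral hδ hδ' hc hD h1 h2 h3 hne
  · have h1 := h.eq_of_dist_le_one hδ hδ' hc (dist_le_one_of_iso f) hD' hpq'
    have h2 := hlt heven
    obtain ⟨p, q, hpq⟩ := T.exists_dist_eq_diam
    have h3 := dist_le_one_of_iso f p q
    omega
  · obtain ⟨p, q, hpq⟩ := T.exists_dist_eq_diam
    have key : ∀ u v, T.dist u v = T.diam →
        2 ≤ T.diam ∧ ∃ u', T.dist u u' + 1 = T.diam ∧ T.dist v u' = T.diam := fun u v huv ↦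
      exists_of_isPeripheral_removeFar hT huv (hw u (isPeripheralVertex_of_dist hT.1 huv))
    exact (h.le_of_odd_weak hδ hδ' hc hD hD' hpq hpq' (key p q hpq).1
      fun u v huv ↦ (key u v huv).2).not_gt (hlt heven)
  · obtain ⟨p, q, hpq, hp, hq⟩ := exists_of_isPeripheral_addLeaf hT.1 hn hv
    exact (h.le_of_even_weak hδ hδ' hc hD hD' hpq hpq' hp hq).not_gt (hlt heven)

lemma Linked.false_of_threeCase (hT : T.IsTree) (hT' : T'.IsTree) {c : V × W → C}
    (hc : RainbowFree (prodDist T.dist T'.dist) c) {d : ℕ} {w : C} {x y : V × W}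
    (h : Linked (prodDist T.dist T'.dist) c d w x y) (hcase : ThreeCase T T') : False := by
  rw [ThreeCase, diam_boxProd hT.1 hT'.1] at hcase
  have left := h.false_of_left hT hT' hc
  have right := h.swap.false_of_left hT' hT hc.swap
  rw [add_comm T'.diam] at right
  tauto

lemma exists_rainbowFree_of_not_threeCase (hT : T.IsTree) (hT' : T'.IsTree)
    (hcase : ¬ ThreeCase T T') : ∃ c : V × W → Fin 3, Function.Surjective c ∧
      RainbowFree (prodDist T.dist T'.dist) c := by
  rw [ThreeCase, diam_boxProd hT.1 hT'.1] at hcase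
  have hδ := isTreeMetric_dist hT
  have hδ' := isTreeMetric_dist hT'
  have h0 := diam_ne_zero_of_connected hT.1
  have h0' := diam_ne_zero_of_connected hT'.1
  rcases Nat.even_or_odd (T.diam + T'.diam) with heven | hodd
  · obtain ⟨p, q, h⟩ := exists_isStrongEndPair hT (by tauto) (by tauto) (by tauto)
    obtain ⟨p', q', h'⟩ := exists_isStrongEndPair hT' (by tauto) (by tauto) (by tauto)
    exact exists_rainbowFree_of_even hδ hδ' heven h h' h0 h0'
  · obtain ⟨p, q, hpq⟩ := T.exists_dist_eq_diam
    obtain ⟨p', q', hpq'⟩ := T'.exists_dist_eq_diam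
    exact exists_rainbowFree_of_odd hδ hδ' hodd
      (isEndPair_of_not_isPeripheral hT (by tauto) hpq)
      (isEndPair_of_not_isPeripheral hT' (by tauto) hpq') h0 h0'

end ThreeCase

end AntiVdW

theorem corollary1p4 {V W : Type*} [Finite V] [Finite W] [Nontrivial V] [Nontrivial W]
    (T : SimpleGraph V) (T' : SimpleGraph W) (hT : T.IsTree) (hT' : T'.IsTree) :
    (AntiVdW.ThreeCase T T' → AntiVdW.aw (T.boxProd T') 3 = 3) ∧
      (¬ AntiVdW.ThreeCase T T' → AntiVdW.aw (T.boxProd T') 3 = 4) := by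
  refine ⟨fun hcase ↦ AntiVdW.aw_eq_three fun c hs ↦ ?_, fun hcase ↦ ?_⟩
  · rw [AntiVdW.hasRainbowAP_boxProd_iff hT hT']
    intro hc
    obtain ⟨d, w, x, y, h⟩ := AntiVdW.exists_linked hT hT' le_rfl hs
    exact h.false_of_threeCase hT hT' hc hcase
  · obtain ⟨c, hs, hc⟩ := AntiVdW.exists_rainbowFree_of_not_threeCase hT hT' hcase
    exact AntiVdW.aw_eq_four (AntiVdW.hasRainbowAP_of_four hT hT') hs
      (by rwa [AntiVdW.hasRainbowAP_boxProd_iff hT hT', not_not])
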